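/- **Notation.** Let $X$ be a finite set and let $\mathcal T_X$ be the semigroup of all maps $X\to X$, with maps written on the right and composed from left to right ($fg$ means first $f$, then $g$). For $f\in\mathcal T_X$ let $\operatorname{im}(f)$, $\ker(f)=\{(x,y):xf=yf\}$ and $\operatorname{rank}(f)=|\operatorname{im}(f)|$ be its image, kernel and rank. Let $a\in\mathcal T_X$ be an idempotent of rank $r\ge 2$. Fix an enumeration $\operatorname{im}(a)=\{a_1,\dots,a_r\}$ and put $A_i=a_i a^{-1}$ (the set of $x\in X$ with $xa=a_i$), $[r]=\{1,\dots,r\}$. The variant $\mathcal T_X^a$ is the set $\mathcal T_X$ with product $f\star g=fag$; let $P=\operatorname{Reg}(\mathcal T_X^a)$ be its subsemigroup of regular elements ($f=f\star g\star f$ for some $g$). Let $T=a\mathcal T_Xa\subseteq P$; it is identified with $\mathcal T_r$, the semigroup of all maps $[r]\to[r]$, through the isomorphism sending $f\in T$ to the map $i\mapsto j$, where $a_if=a_j$. Let $\phi:P\to T$, $f\mapsto afa$, be the canonical retraction, and put $$\kappa=\ker\phi=\{(f,g)\in P\times P: afa=aga\},\qquad \lambda=\kappa\cap\mathscr L^P,\qquad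 \rho=\kappa\cap\mathscr R^P,$$ where $\mathscr L^P,\mathscr R^P$ are Green's relations of $P$; these are congruences of $P$. For a semigroup $S$, $\operatorname{Cong}(S)$ is its lattice of congruences and $\Delta_S$ is the equality relation; $\operatorname{Eq}(Z)$ is the lattice of equivalence relations on a set $Z$. Intervals $[\Delta_P,\mu]$ are taken in $\operatorname{Cong}(P)$. For $\xi\in\operatorname{Cong}(\mathcal T_r)$ and $\theta\in[\Delta_P,\kappa]$ define $$\operatorname{rank}(\xi)=\max\{0\le q\le r: R_{I_q^{\mathcal T_r}}\subseteq\xi\},\qquad \operatorname{rank}(\theta)=\max\{0\le q\le r: \kappa\cap R_{I_q^{P}}\subseteq\theta\},$$ where $I_q^S=\{f\in S:\operatorname{rank}(f)\le q\}$ and $R_I=\{(x,y): x=y\text{ or }x,y\in I\}$. A *subdirect embedding* is an injective lattice morphism into a direct product of lattices whose image projects onto every factor. For $\emptyset\ne I\subseteq[r]$ let $\mathcal C_I$ be the set of all sets $C=\{c_i:i\in I\}$ with $c_i\in A_i$ for every $i\in I$. For $\emptyset\ne J\subseteq I$ put $C{\restriction}_J=\{c_j:j\in J\}\in\mathcal C_J$,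 and for a relation $\psi$ on $\mathcal C_I$ put $\psi{\restriction}_J=\{(C{\restriction}_J,C'{\restriction}_J):(C,C')\in\psi\}$. For partitions $\mathbf I,\mathbf J$ of $[r]$ write $\mathbf J\preceq\mathbf I$ if every block of $\mathbf I$ is contained in a block of $\mathbf J$; thus $\mathbf I\preceq[\![r]\!]=\{\{1\},\dots,\{r\}\}$ for every partition $\mathbf I$ of $[r]$. Let $\mathcal P_{\mathbf I}$ be the set of all partitions of $X$ of the form $\mathbf P=\{P_I:I\in\mathbf I\}$ with $P_I\cap\operatorname{im}(a)=\{a_i:i\in I\}$ for every $I\in\mathbf I$. For $\mathbf J\preceq\mathbf I$ put $\mathbf P{\restriction}_{\mathbf J}=\{Q_J:J\in\mathbf J\}\in\mathcal P_{\mathbf J}$ with $Q_J=\bigcup\{P_I:I\in\mathbf I,\ I\subseteq J\}$, and for a relation $\psi$ on $\mathcal P_{\mathbf I}$ put $\psi{\restriction}_{\mathbf J}=\{(\mathbf P{\restriction}_{\mathbf J},\mathbf P'{\restriction}_{\mathbf J}):(\mathbf P,\mathbf P')\in\psi\}$. **Theorem.** With this notation (and $r\geq 2$), the following hold. (i) The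 map $\sigma\mapsto(\sigma{\restriction}_T,\ \sigma\cap\kappa)$, where $\sigma{\restriction}_T=\sigma\cap(T\times T)$, is a subdirect embedding of $\operatorname{Cong}(P)$ into $\operatorname{Cong}(\mathcal T_r)\times[\Delta_P,\kappa]$, with image $$\{(\xi,\theta)\in\operatorname{Cong}(\mathcal T_r)\times[\Delta_P,\kappa]:\operatorname{rank}(\xi)\le\operatorname{rank}(\theta)\}.$$ (ii) The map $\theta\mapsto(\theta\cap\lambda,\theta\cap\rho)$ is a lattice isomorphism $[\Delta_P,\kappa]\to[\Delta_P,\lambda]\times[\Delta_P,\rho]$. (iii) For $\theta\in[\Delta_P,\rho]$ and $\emptyset\ne I\subseteq[r]$ let $\Psi_I(\theta)$ be the set of pairs $(C,C')\in\mathcal C_I\times\mathcal C_I$ for which there is $(f,g)\in\theta$ with $\operatorname{im}(f)=C$ and $\operatorname{im}(g)=C'$. Each $\Psi_I(\theta)$ is an equivalence relation on $\mathcal C_I$, and $\theta\mapsto(\Psi_I(\theta))_I$ is a subdirect embedding of $[\Delta_P,\rho]$ into $\prod_{\emptyset\ne I\subseteq[r]}\operatorname{Eq}(\mathcal C_I)$,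 with image $$\Big\{(\psi_I)\in\prod_{\emptyset\ne I\subseteq[r]}\operatorname{Eq}(\mathcal C_I):\psi_I{\restriction}_J\subseteq\psi_J\text{ for all }\emptyset\ne J\subseteq I\subseteq[r]\Big\}.$$ (iv) For $\theta\in[\Delta_P,\lambda]$ and a partition $\mathbf I$ of $[r]$ let $\Psi_{\mathbf I}(\theta)$ be the set of pairs $(\mathbf P,\mathbf P')\in\mathcal P_{\mathbf I}\times\mathcal P_{\mathbf I}$ for which there is $(f,g)\in\theta$ with $X/\ker(f)=\mathbf P$ and $X/\ker(g)=\mathbf P'$. Each $\Psi_{\mathbf I}(\theta)$ is an equivalence relation on $\mathcal P_{\mathbf I}$, and $\theta\mapsto(\Psi_{\mathbf I}(\theta))_{\mathbf I}$ is a subdirect embedding of $[\Delta_P,\lambda]$ into $\prod_{\mathbf I\preceq[\![r]\!]}\operatorname{Eq}(\mathcal P_{\mathbf I})$, with image $$\Big\{(\psi_{\mathbf I})\in\prod_{\mathbf I\preceq[\![r]\!]}\operatorname{Eq}(\mathcal P_{\mathbf I}):\psi_{\mathbf I}{\restriction}_{\mathbf J}\subseteq\psi_{\mathbf J}\text{ for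 all }\mathbf J\preceq\mathbf I\preceq[\![r]\!]\Big\}.$$ -/

import Mathlib

namespace VariantCong

/-! ### Lattice vocabulary -/

/-- `f : L → M` preserves binary meets and joins. -/
structure IsLatticeMorphism {L M : Type*} [Lattice L] [Lattice M] (f : L → M) : Prop where
  map_inf : ∀ x y, f (x ⊓ y) = f x ⊓ f y
  map_sup : ∀ x y, f (x ⊔ y) = f x ⊔ f y

/-- A lattice isomorphism: a bijective lattice morphism. -/
structure IsLatticeIso {L M : Type*} [Lattice L] [Lattice M] (f : L → M) : Prop where
  morphism : IsLatticeMorphism f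
  bijective : Function.Bijective f

/-- A subdirect embedding into a product of two lattices: an injective lattice morphism whose
image projects onto both factors. -/
structure IsSubdirectEmbedding₂ {L M N : Type*} [Lattice L] [Lattice M] [Lattice N]
    (f : L → M × N) : Prop where
  morphism : IsLatticeMorphism f
  injective : Function.Injective f
  surjective_fst : Function.Surjective fun x => (f x).1
  surjective_snd : Function.Surjective fun x => (f x).2

/-- A subdirect embedding into the product of a family of lattices: an injective lattice morphism
whose image projects onto every factor. -/
structure IsSubdirectEmbedding {ι : Type*} {L : Type*} [Lattice L] {M : ι → Type*}
    [∀ i, Lattice (M i)] (f : L → ∀ i, M i) : Prop where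
  morphism : IsLatticeMorphism f
  injective : Function.Injective f
  surjective : ∀ i, Function.Surjective fun x => f x i

/-! ### Semigroup vocabulary -/

/-- `x` is a regular element: `x ∈ x S x`. -/
def IsRegularElt {S : Type*} [Mul S] (x : S) : Prop := ∃ y, x = x * y * x

/-- Green's preorder: `x ∈ S¹ y`. -/
def LeL {S : Type*} [Mul S] (x y : S) : Prop := x = y ∨ ∃ s, x = s * y

/-- Green's preorder: `x ∈ y S¹`. -/
def LeR {S : Type*} [Mul S] (x y : S) : Prop := x = y ∨ ∃ s, x = y * s

/-- Green's relation `ℒ`. -/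
def GreenL {S : Type*} [Mul S] (x y : S) : Prop := LeL x y ∧ LeL y x

/-- Green's relation `ℛ`. -/
def GreenR {S : Type*} [Mul S] (x y : S) : Prop := LeR x y ∧ LeR y x

/-- The Rees relation `∇_I ∪ Δ` of a subset `I`. -/
def ReesRel {S : Type*} (I : Set S) (x y : S) : Prop := x = y ∨ (x ∈ I ∧ y ∈ I)

/-! ### Transformations, variants and the regular part -/

/-- The full transformation semigroup on `X`. As maps are written on the right,
`f * g` means: first `f`, then `g`. -/
def Transf (X : Type*) := X → X

instance {X : Type*} : Semigroup (Transf X) where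
  mul f g := fun x => g (f x)
  mul_assoc _ _ _ := rfl

/-- The image of a transformation. -/
def Transf.im {X : Type*} (f : Transf X) : Set X := Set.range fun x => f x

/-- The rank of a transformation (of a finite set): the size of its image. -/
noncomputable def Transf.rank {X : Type*} (f : Transf X) : ℕ := f.im.ncard

/-- The set `X / ker f` of classes of the kernel of `f`. -/
def Transf.kerClasses {X : Type*} (f : Transf X) : Set (Set X) :=
  (Setoid.ker fun x => f x).classes

/-- The variant of the full transformation semigroup with sandwich element `a`. -/
def Variant {X : Type*} (_a : Transf X) := Transf X

/-- The underlying transformation of an element of the variant. -/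
def Variant.toTransf {X : Type*} {a : Transf X} (f : Variant a) : Transf X := f

/-- A transformation as an element of the variant. -/
def Variant.of {X : Type*} (a : Transf X) (f : Transf X) : Variant a := f

/-- The sandwich operation `f ⋆ g = f a g`. -/
instance {X : Type*} (a : Transf X) : Semigroup (Variant a) where
  mul f g := Variant.of a (f.toTransf * a * g.toTransf)
  mul_assoc _ _ _ := rfl

theorem Variant.toTransf_mul {X : Type*} {a : Transf X} (f g : Variant a) :
    (f * g).toTransf = f.toTransf * a * g.toTransf := rfl

theorem Variant.mul_apply {X : Type*} {a : Transf X} (f g : Variant a) (x : X) :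
    (f * g).toTransf x = g.toTransf (a (f.toTransf x)) := rfl

/-- A regularity criterion in a variant, used for closure under products. -/
theorem isRegularElt_variant_iff {X : Type*} {a : Transf X} (f : Variant a) :
    IsRegularElt f ↔
      (∀ x y, a (f.toTransf x) = a (f.toTransf y) → f.toTransf x = f.toTransf y) ∧
        ∀ x, ∃ w, f.toTransf (a w) = f.toTransf x := by
  constructor
  · rintro ⟨g, hg⟩
    have h : ∀ x, f.toTransf x = f.toTransf (a (g.toTransf (a (f.toTransf x)))) := fun x =>
      congrArg (fun k : Variant a => k.toTransf x) hg
    exact ⟨fun x y hxy => by rw [h x, h y, hxy], fun x => ⟨_, (h x).symm⟩⟩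
  · rintro ⟨h1, h2⟩
    classical
    choose w hw using h2
    refine ⟨Variant.of a fun y => if h : ∃ x, a (f.toTransf x) = y then w h.choose else y, ?_⟩
    funext x
    have hx : ∃ z, a (f.toTransf z) = a (f.toTransf x) := ⟨x, rfl⟩
    change f.toTransf x = f.toTransf (a (if h : ∃ z, a (f.toTransf z) = a (f.toTransf x)
      then w h.choose else a (f.toTransf x)))
    rw [dif_pos hx, hw]
    exact (h1 _ _ hx.choose_spec).symm

/-- `P`, the semigroup of all regular elements of the variant. -/
def Reg {X : Type*} (a : Transf X) : Subsemigroup (Variant a) where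
  carrier := {f | IsRegularElt f}
  mul_mem' := by
    intro f g hf hg
    rw [Set.mem_ofPred_eq, isRegularElt_variant_iff] at *
    refine ⟨fun x y h => hg.1 _ _ h, fun x => ?_⟩
    obtain ⟨w, hw⟩ := hf.2 x
    exact ⟨w, by rw [Variant.mul_apply, Variant.mul_apply, hw]⟩

/-- `T = a 𝒯_X a`, as a subsemigroup of the variant. -/
def Corner {X : Type*} (a : Transf X) : Subsemigroup (Variant a) where
  carrier := {f | ∃ g : Transf X, f.toTransf = a * g * a}
  mul_mem' := by
    rintro f h ⟨g, hg⟩ ⟨k, hk⟩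
    exact ⟨g * a * a * a * k, by rw [Variant.toTransf_mul, hg, hk]; rfl⟩

section

variable {X : Type*} {a : Transf X}

theorem idem_apply (ha : IsIdempotentElem a) (x : X) : a (a x) = a x := congrFun ha x

theorem corner_apply_left (ha : IsIdempotentElem a) (f : Corner a) (x : X) :
    f.1.toTransf (a x) = f.1.toTransf x := by
  obtain ⟨f, g, hg⟩ := f
  have h : ∀ x, f.toTransf x = a (g (a x)) := fun x => congrFun hg x
  simp only [h, idem_apply ha]

theorem corner_apply_right (ha : IsIdempotentElem a) (f : Corner a) (x : X) :
    a (f.1.toTransf x) = f.1.toTransf x := by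
  obtain ⟨f, g, hg⟩ := f
  have h : ∀ x, f.toTransf x = a (g (a x)) := fun x => congrFun hg x
  simp only [h, idem_apply ha]

theorem corner_le_reg (ha : IsIdempotentElem a) : Corner a ≤ Reg a := by
  intro f hf
  refine (isRegularElt_variant_iff f).2 ⟨fun x y h => ?_, fun x => ⟨x, ?_⟩⟩
  · simpa only [corner_apply_right ha ⟨f, hf⟩] using h
  · exact corner_apply_left ha ⟨f, hf⟩ x

/-- The retraction `φ : P → T`, `f ↦ a f a`. -/
def phi (ha : IsIdempotentElem a) : Reg a →ₙ* Corner a where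
  toFun f := ⟨Variant.of a (a * f.1.toTransf * a), f.1.toTransf, rfl⟩
  map_mul' f g := by
    apply Subtype.ext
    funext x
    change a (g.1.toTransf (a (f.1.toTransf (a x)))) =
      a (g.1.toTransf (a (a (a (f.1.toTransf (a x))))))
    simp only [idem_apply ha]

/-- `κ = ker φ`. -/
def kappa (ha : IsIdempotentElem a) : Con (Reg a) := Con.ker (phi ha)

theorem kappa_apply (ha : IsIdempotentElem a) (f g : Reg a) :
    kappa ha f g ↔ ∀ x, a (f.1.toTransf (a x)) = a (g.1.toTransf (a x)) := by
  constructor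
  · intro h x
    exact congrFun (congrArg (fun k : Corner a => k.1.toTransf) h) x
  · intro h
    exact Subtype.ext (funext h)

theorem reg_ext {f g : Reg a} (h : ∀ x, f.1.toTransf x = g.1.toTransf x) : f = g :=
  Subtype.ext (funext h)

/-- `ρ = κ ∩ ℛ^P`. -/
def rho (ha : IsIdempotentElem a) : Con (Reg a) where
  r f g := kappa ha f g ∧ GreenR f g
  iseqv := by
    refine ⟨fun f => ⟨(kappa ha).refl f, Or.inl rfl, Or.inl rfl⟩,
      fun h => ⟨(kappa ha).symm h.1, h.2.2, h.2.1⟩, fun h k => ⟨(kappa ha).trans h.1 k.1, ?_, ?_⟩⟩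
    · rcases h.2.1 with rfl | ⟨s, hs⟩
      · exact k.2.1
      · rcases k.2.1 with rfl | ⟨t, ht⟩
        · exact Or.inr ⟨s, hs⟩
        · exact Or.inr ⟨t * s, by rw [hs, ht, mul_assoc]⟩
    · rcases k.2.2 with rfl | ⟨s, hs⟩
      · exact h.2.2
      · rcases h.2.2 with rfl | ⟨t, ht⟩
        · exact Or.inr ⟨s, hs⟩
        · exact Or.inr ⟨t * s, by rw [hs, ht, mul_assoc]⟩
  mul' := by
    rintro f g h k ⟨hfg, hR⟩ ⟨hhk, hS⟩
    -- right multiplication cannot separate `ρ`-related elements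
    have key : f * h = g * h := by
      obtain ⟨y, hy⟩ := f.2
      have hf : ∀ x, f.1.toTransf x = f.1.toTransf (a (y.toTransf (a (f.1.toTransf x)))) := fun x =>
        congrFun (congrArg (fun k : Variant a => k.toTransf) hy) x
      have hg : ∀ x, g.1.toTransf x = g.1.toTransf (a (y.toTransf (a (f.1.toTransf x)))) := by
        intro x
        rcases hR.2 with hgf | ⟨s, hs⟩
        · rw [hgf]; exact hf x
        · have e : ∀ z, g.1.toTransf z = s.1.toTransf (a (f.1.toTransf z)) := fun z =>
            congrFun (congrArg (fun k : Reg a => k.1.toTransf) hs) z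
          rw [e, e, ← hf]
      refine reg_ext fun x => ?_
      change h.1.toTransf (a (f.1.toTransf x)) = h.1.toTransf (a (g.1.toTransf x))
      have e := (kappa_apply ha f g).1 hfg (y.toTransf (a (f.1.toTransf x)))
      rw [hf x, hg x, e]
    refine ⟨(kappa ha).mul hfg hhk, ?_⟩
    rw [key]
    constructor
    · rcases hS.1 with rfl | ⟨s, hs⟩
      · exact Or.inl rfl
      · exact Or.inr ⟨s, by rw [hs, mul_assoc]⟩
    · rcases hS.2 with rfl | ⟨s, hs⟩
      · exact Or.inl rfl
      · exact Or.inr ⟨s, by rw [hs, mul_assoc]⟩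

/-- `λ = κ ∩ ℒ^P`. -/
def lam (ha : IsIdempotentElem a) : Con (Reg a) where
  r f g := kappa ha f g ∧ GreenL f g
  iseqv := by
    refine ⟨fun f => ⟨(kappa ha).refl f, Or.inl rfl, Or.inl rfl⟩,
      fun h => ⟨(kappa ha).symm h.1, h.2.2, h.2.1⟩, fun h k => ⟨(kappa ha).trans h.1 k.1, ?_, ?_⟩⟩
    · rcases h.2.1 with rfl | ⟨s, hs⟩
      · exact k.2.1
      · rcases k.2.1 with rfl | ⟨t, ht⟩
        · exact Or.inr ⟨s, hs⟩
        · exact Or.inr ⟨s * t, by rw [hs, ht, mul_assoc]⟩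
    · rcases k.2.2 with rfl | ⟨s, hs⟩
      · exact h.2.2
      · rcases h.2.2 with rfl | ⟨t, ht⟩
        · exact Or.inr ⟨s, hs⟩
        · exact Or.inr ⟨s * t, by rw [hs, ht, mul_assoc]⟩
  mul' := by
    rintro f g h k ⟨hfg, hR⟩ ⟨hhk, hS⟩
    -- left multiplication cannot separate `λ`-related elements
    have key : f * h = f * k := by
      obtain ⟨y, hy⟩ := h.2
      have hh : ∀ x, h.1.toTransf x = h.1.toTransf (a (y.toTransf (a (h.1.toTransf x)))) := fun x =>
        congrFun (congrArg (fun k : Variant a => k.toTransf) hy) x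
      have hk : ∀ x, k.1.toTransf x = h.1.toTransf (a (y.toTransf (a (k.1.toTransf x)))) := by
        intro x
        rcases hS.2 with hkh | ⟨s, hs⟩
        · rw [hkh]; exact hh x
        · have e : ∀ z, k.1.toTransf z = h.1.toTransf (a (s.1.toTransf z)) := fun z =>
            congrFun (congrArg (fun k : Reg a => k.1.toTransf) hs) z
          rw [e, ← hh]
      refine reg_ext fun x => ?_
      change h.1.toTransf (a (f.1.toTransf x)) = k.1.toTransf (a (f.1.toTransf x))
      have e := (kappa_apply ha h k).1 hhk (f.1.toTransf x)
      rw [hh (a (f.1.toTransf x)), hk (a (f.1.toTransf x)), e]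
    refine ⟨(kappa ha).mul hfg hhk, ?_⟩
    rw [show GreenL (f * h) (g * k) = GreenL (f * k) (g * k) by rw [key]]
    constructor
    · rcases hR.1 with rfl | ⟨s, hs⟩
      · exact Or.inl rfl
      · exact Or.inr ⟨s, by rw [hs, mul_assoc]⟩
    · rcases hR.2 with rfl | ⟨s, hs⟩
      · exact Or.inl rfl
      · exact Or.inr ⟨s, by rw [hs, mul_assoc]⟩

/-- The isomorphism `T ≅ 𝒯_r` determined by an enumeration `a_1, …, a_r` of the image of `a`:
`f ∈ T` goes to the transformation `i ↦ j` with `f(a_i) = a_j`. -/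
noncomputable def cornerIso (ha : IsIdempotentElem a) {r : ℕ} (α : Fin r ≃ a.im) :
    Corner a ≃* Transf (Fin r) where
  toFun f := fun i => α.symm ⟨f.1.toTransf (α i).1, f.1.toTransf (α i).1,
    corner_apply_right ha f _⟩
  invFun h := ⟨Variant.of a fun x => (α (h (α.symm ⟨a x, x, rfl⟩))).1,
    ⟨fun x => (α (h (α.symm ⟨a x, x, rfl⟩))).1, by
      funext x
      change (α (h (α.symm ⟨a x, _⟩))).1 = a (α (h (α.symm ⟨a (a x), _⟩))).1
      obtain ⟨z, hz⟩ := (α (h (α.symm ⟨a x, x, rfl⟩))).2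
      simp only [idem_apply ha]
      rw [← hz]
      exact (idem_apply ha z).symm⟩⟩
  left_inv f := by
    apply Subtype.ext
    funext x
    change (α (α.symm ⟨f.1.toTransf (α (α.symm ⟨a x, x, rfl⟩)).1, _⟩)).1 = f.1.toTransf x
    simp only [Equiv.apply_symm_apply]
    exact corner_apply_left ha f x
  right_inv h := by
    funext i
    change α.symm ⟨(α (h (α.symm ⟨a (α i).1, _⟩))).1, _⟩ = h i
    have e : (⟨a (α i).1, (α i).1, rfl⟩ : a.im) = α i := by
      apply Subtype.ext
      obtain ⟨z, hz⟩ := (α i).2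
      change a (α i).1 = (α i).1
      rw [← hz]
      exact idem_apply ha z
    simp only [e, Equiv.symm_apply_apply, Subtype.coe_eta]
  map_mul' f g := by
    funext i
    change α.symm ⟨g.1.toTransf (a (f.1.toTransf (α i).1)), _⟩ =
      α.symm ⟨g.1.toTransf (α (α.symm ⟨f.1.toTransf (α i).1, _⟩)).1, _⟩
    simp only [Equiv.apply_symm_apply, corner_apply_left ha g]

/-- The restriction `σ|_T = σ ∩ (T × T)`, a congruence of `T`. -/
def restrictT (ha : IsIdempotentElem a) (σ : Con (Reg a)) : Con (Corner a) :=
  Con.comap (Subsemigroup.inclusion (corner_le_reg ha)) (map_mul _) σ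

/-- `σ|_T`, regarded as a congruence of `𝒯_r` along the isomorphism `T ≅ 𝒯_r`. -/
noncomputable def restrictTr (ha : IsIdempotentElem a) {r : ℕ} (α : Fin r ≃ a.im)
    (σ : Con (Reg a)) : Con (Transf (Fin r)) :=
  Con.comap (cornerIso ha α).symm (map_mul _) (restrictT ha σ)

/-- The meet with a congruence `τ ≤ μ`, as a map of intervals `[Δ, μ] → [Δ, τ]`. -/
def meetIcc {S : Type*} [Mul S] (μ τ : Con S) (θ : Set.Icc (⊥ : Con S) μ) :
    Set.Icc (⊥ : Con S) τ :=
  ⟨θ.1 ⊓ τ, bot_le, inf_le_right⟩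

/-- The map `Cong(P) → Cong(𝒯_r) × [Δ_P, κ]`, `σ ↦ (σ|_T, σ ∩ κ)`. -/
noncomputable def congMap (ha : IsIdempotentElem a) {r : ℕ} (α : Fin r ≃ a.im)
    (σ : Con (Reg a)) : Con (Transf (Fin r)) × Set.Icc (⊥ : Con (Reg a)) (kappa ha) :=
  (restrictTr ha α σ, ⟨σ ⊓ kappa ha, bot_le, inf_le_right⟩)

/-- The map `[Δ_P, κ] → [Δ_P, λ] × [Δ_P, ρ]`, `θ ↦ (θ ∩ λ, θ ∩ ρ)`. -/
def kappaMap (ha : IsIdempotentElem a) (θ : Set.Icc (⊥ : Con (Reg a)) (kappa ha)) :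
    Set.Icc (⊥ : Con (Reg a)) (lam ha) × Set.Icc (⊥ : Con (Reg a)) (rho ha) :=
  (meetIcc _ _ θ, meetIcc _ _ θ)

open Classical in
/-- `rank ξ = max {q ≤ r : R_{I_q} ⊆ ξ}` for a congruence `ξ` of `𝒯_r`, where
`I_q` is the set of elements of rank at most `q` (so that `I_0` is empty for `r ≥ 1`). -/
noncomputable def rankTr {r : ℕ} (ξ : Con (Transf (Fin r))) : ℕ :=
  Nat.findGreatest
    (fun q => ∀ f g, ReesRel {h : Transf (Fin r) | h.rank ≤ q} f g → ξ f g) r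

open Classical in
/-- `rank θ = max {q ≤ r : κ ∩ R_{I_q} ⊆ θ}` for a congruence `θ` of `P`, where `I_q` is the set
of elements of `P` of rank at most `q`, and `r` is the rank of `a`. -/
noncomputable def rankKappa (ha : IsIdempotentElem a) (θ : Con (Reg a)) : ℕ :=
  Nat.findGreatest
    (fun q => ∀ f g, kappa ha f g ∧ ReesRel {h : Reg a | h.1.toTransf.rank ≤ q} f g → θ f g) a.rank

end

/-! ### Cross-sections -/

section

variable {X : Type*} {a : Transf X} {r : ℕ}

/-- The kernel class `A_i` of `a`, with image `a_i`. -/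
def block (α : Fin r ≃ a.im) (i : Fin r) : Set X := {x | a x = (α i).1}

/-- `C` is a cross-section of `{A_i : i ∈ I}`: it has the form `{c_i : i ∈ I}` with `c_i ∈ A_i`. -/
def IsCrossSection (α : Fin r ≃ a.im) (I : Set (Fin r)) (C : Set X) : Prop :=
  ∃ c : Fin r → X, (∀ i ∈ I, c i ∈ block α i) ∧ C = c '' I

/-- The non-empty subsets of `[r]`. -/
abbrev NESubset (r : ℕ) := {I : Set (Fin r) // I.Nonempty}

/-- `𝒞_I`, the set of cross-sections of `{A_i : i ∈ I}`. -/
def CrossSections (α : Fin r ≃ a.im) (I : NESubset r) : Type _ :=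
  {C : Set X // IsCrossSection α I.1 C}

/-- The part of a set lying in the classes `A_j`, `j ∈ J`. -/
def crossRestrict (α : Fin r ≃ a.im) (J : Set (Fin r)) (C : Set X) : Set X :=
  C ∩ ⋃ j ∈ J, block α j

/-- On cross-sections this is the restriction `{c_i : i ∈ I} ↦ {c_j : j ∈ J}`. -/
theorem crossRestrict_image (α : Fin r ≃ a.im) {I J : Set (Fin r)} (hJI : J ⊆ I)
    (c : Fin r → X) (hc : ∀ i ∈ I, c i ∈ block α i) :
    crossRestrict α J (c '' I) = c '' J := by
  ext x
  simp only [crossRestrict, Set.mem_inter_iff, Set.mem_image, Set.mem_iUnion]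
  constructor
  · rintro ⟨⟨i, hi, rfl⟩, j, hj, hij⟩
    have e : (α i).1 = (α j).1 := (hc i hi).symm.trans hij
    have : i = j := α.injective (Subtype.ext e)
    exact ⟨i, this ▸ hj, rfl⟩
  · rintro ⟨j, hj, rfl⟩
    exact ⟨⟨j, hJI hj, rfl⟩, j, hj, hc j (hJI hj)⟩

/-- The restriction map `C ↦ C|_J` from `𝒞_I` to `𝒞_J`, for `J ⊆ I`. -/
def CrossSections.restrict (α : Fin r ≃ a.im) {I J : NESubset r} (hJI : J.1 ⊆ I.1)
    (C : CrossSections α I) : CrossSections α J :=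
  ⟨crossRestrict α J.1 C.1, by
    obtain ⟨C, c, hc, rfl⟩ := C
    exact ⟨c, fun j hj => hc j (hJI hj), crossRestrict_image α hJI c hc⟩⟩

/-- The families of equivalences `(ψ_I)` with `ψ_I|_J ⊆ ψ_J` for all `∅ ≠ J ⊆ I ⊆ [r]`. -/
def CrossClosed (α : Fin r ≃ a.im) (ψ : ∀ I : NESubset r, Setoid (CrossSections α I)) : Prop :=
  ∀ (I J : NESubset r) (hJI : J.1 ⊆ I.1) (D D' : CrossSections α J),
    Relation.Map (ψ I) (CrossSections.restrict α hJI) (CrossSections.restrict α hJI) D D' →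
      ψ J D D'

/-! ### Partitions -/

/-- The partitions of `[r]`. -/
abbrev Part (r : ℕ) := {I : Set (Set (Fin r)) // Setoid.IsPartition I}

/-- `𝐉 ⪯ 𝐈`: every block of `𝐈` is contained in a block of `𝐉`. -/
def Coarser (J I : Part r) : Prop := ∀ B ∈ I.1, ∃ C ∈ J.1, B ⊆ C

/-- The set `{a_i : i ∈ I}`. -/
def imSet (α : Fin r ≃ a.im) (I : Set (Fin r)) : Set X := (fun i => (α i).1) '' I

/-- `𝐏` is a partition of `X` of the form `{P_I : I ∈ 𝐈}` with `P_I ∩ im(a) = {a_i : i ∈ I}`. -/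
def IsPartitionOver (α : Fin r ≃ a.im) (I : Set (Set (Fin r))) (P : Set (Set X)) : Prop :=
  Setoid.IsPartition P ∧ ∃ p : Set (Fin r) → Set X,
    (∀ B ∈ I, p B ∩ a.im = imSet α B) ∧ P = p '' I

/-- `𝒫_𝐈`. -/
def PartitionsOver (α : Fin r ≃ a.im) (I : Part r) : Type _ :=
  {P : Set (Set X) // IsPartitionOver α I.1 P}

/-- The union of those blocks in `P` that meet `im(a)` inside `{a_j : j ∈ J}`. -/
def unionOver (α : Fin r ≃ a.im) (P : Set (Set X)) (J : Set (Fin r)) : Set X :=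
  ⋃₀ {B ∈ P | B ∩ a.im ⊆ imSet α J}

theorem imSet_subset_iff (α : Fin r ≃ a.im) {I J : Set (Fin r)} :
    imSet α I ⊆ imSet α J ↔ I ⊆ J :=
  Set.image_subset_image_iff (Subtype.val_injective.comp α.injective)

/-- For `𝐏 = {P_I : I ∈ 𝐈}` this is the union of the `P_I` with `I ∈ 𝐈`, `I ⊆ J`. -/
theorem unionOver_image (α : Fin r ≃ a.im) {I : Set (Set (Fin r))} (p : Set (Fin r) → Set X)
    (hp : ∀ B ∈ I, p B ∩ a.im = imSet α B) (J : Set (Fin r)) :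
    unionOver α (p '' I) J = ⋃₀ (p '' {B ∈ I | B ⊆ J}) := by
  unfold unionOver
  congr 1
  ext Q
  constructor
  · rintro ⟨⟨B, hB, rfl⟩, h⟩
    rw [hp B hB, imSet_subset_iff] at h
    exact ⟨B, ⟨hB, h⟩, rfl⟩
  · rintro ⟨B, ⟨hB, h⟩, rfl⟩
    exact ⟨⟨B, hB, rfl⟩, by rw [hp B hB, imSet_subset_iff]; exact h⟩

theorem isPartitionOver_restrict (α : Fin r ≃ a.im) {I J : Part r} (hJI : Coarser J I)
    {P : Set (Set X)} (hP : IsPartitionOver α I.1 P) :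
    IsPartitionOver α J.1 (unionOver α P '' J.1) := by
  obtain ⟨hpart, p, hp, rfl⟩ := hP
  -- the blocks of `𝐉` met by a block of `𝐈`
  have sub : ∀ B ∈ I.1, ∀ C ∈ J.1, (B ∩ C).Nonempty → B ⊆ C := by
    rintro B hB C hC ⟨i, hiB, hiC⟩
    obtain ⟨C', hC', hBC'⟩ := hJI B hB
    have := (J.2.2 i).unique ⟨hC', hBC' hiB⟩ ⟨hC, hiC⟩
    exact this ▸ hBC'
  have hne : ∀ B ∈ I.1, B.Nonempty := fun B hB => Setoid.nonempty_of_mem_partition I.2 hB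
  have hU : ∀ C ∈ J.1, unionOver α (p '' I.1) C ∩ a.im = imSet α C := by
    intro C hC
    rw [unionOver_image α p hp]
    ext x
    constructor
    · rintro ⟨⟨_, ⟨B, ⟨hB, hBC⟩, rfl⟩, hx⟩, hxa⟩
      have : x ∈ imSet α B := hp B hB ▸ ⟨hx, hxa⟩
      exact (imSet_subset_iff α).2 hBC this
    · rintro ⟨i, hi, rfl⟩
      obtain ⟨B, ⟨hB, hiB⟩, -⟩ := I.2.2 i
      have hBC := sub B hB C hC ⟨i, hiB, hi⟩
      have : (α i).1 ∈ p B ∩ a.im := by rw [hp B hB]; exact ⟨i, hiB, rfl⟩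
      exact ⟨⟨_, ⟨B, ⟨hB, hBC⟩, rfl⟩, this.1⟩, this.2⟩
  refine ⟨⟨?_, fun x => ?_⟩, _, hU, rfl⟩
  · rintro ⟨C, hC, h0⟩
    obtain ⟨i, hi⟩ := Setoid.nonempty_of_mem_partition J.2 hC
    have h := hU C hC
    rw [h0, Set.empty_inter] at h
    have hmem : (α i).1 ∈ imSet α C := ⟨i, hi, rfl⟩
    rw [← h] at hmem
    exact hmem
  · obtain ⟨_, ⟨⟨B, hB, rfl⟩, hxB⟩, huniq⟩ := hpart.2 x
    obtain ⟨C, hC, hBC⟩ := hJI B hB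
    refine ⟨unionOver α (p '' I.1) C, ⟨⟨C, hC, rfl⟩, ?_⟩, ?_⟩
    · rw [unionOver_image α p hp]
      exact ⟨_, ⟨B, ⟨hB, hBC⟩, rfl⟩, hxB⟩
    · rintro _ ⟨⟨C', hC', rfl⟩, hx⟩
      rw [unionOver_image α p hp] at hx
      obtain ⟨_, ⟨B', ⟨hB', hBC'⟩, rfl⟩, hx⟩ := hx
      have e : p B' = p B := huniq _ ⟨⟨B', hB', rfl⟩, hx⟩
      have e' : imSet α B' = imSet α B := by rw [← hp B' hB', ← hp B hB, e]
      have hsub : B ⊆ B' := (imSet_subset_iff α).1 e'.ge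
      obtain ⟨i, hi⟩ := hne B hB
      have : C' = C := (J.2.2 i).unique ⟨hC', hBC' (hsub hi)⟩ ⟨hC, hBC hi⟩
      rw [this]

/-- The restriction map `𝐏 ↦ 𝐏|_𝐉 = {Q_J : J ∈ 𝐉}` from `𝒫_𝐈` to `𝒫_𝐉`, for `𝐉 ⪯ 𝐈`, where `Q_J`
is the union of the blocks `P_I` with `I ⊆ J`. -/
def PartitionsOver.restrict (α : Fin r ≃ a.im) {I J : Part r} (hJI : Coarser J I)
    (P : PartitionsOver α I) : PartitionsOver α J :=
  ⟨unionOver α P.1 '' J.1, isPartitionOver_restrict α hJI P.2⟩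

/-- The families of equivalences `(ψ_𝐈)` with `ψ_𝐈|_𝐉 ⊆ ψ_𝐉` for all partitions `𝐉 ⪯ 𝐈`. -/
def PartClosed (α : Fin r ≃ a.im) (ψ : ∀ I : Part r, Setoid (PartitionsOver α I)) : Prop :=
  ∀ (I J : Part r) (hJI : Coarser J I) (D D' : PartitionsOver α J),
    Relation.Map (ψ I) (PartitionsOver.restrict α hJI) (PartitionsOver.restrict α hJI) D D' →
      ψ J D D'

end

end VariantCong

namespace VariantCong

/-! ### Lattice lemmas -/

/-! Every element of `P` is a product `k t c`, written `elt k t c`: a retraction `k : X → [r]` with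
`a_i ↦ i`, a map `t` in `𝒯_r`, and a section `c` with `c_i ∈ A_i`. Since `a` followed by `k` undoes
any section, the inner coordinates of a product cancel: `(k, s, c)(l, t, d) = (k, st, d)`
(`elt_mul`). The coordinates are unique up to changing `k` modulo the kernel of `t` and `c` off the
image of `t` (`elt_eq_iff`). The retraction `φ` keeps only `t`; inside `κ`, the relation `λ` fixes
the image coordinate and `ρ` the kernel coordinate.

Multiplying by suitable elements on either side shows that a congruence splits into three conditions
(`con_elt_iff`): one on the projections `s`, `t`, one on `k`, `l` (`LamAt`), one on `c`, `d`
(`RhoAt`). The relation `LamAt` at `s` can only grow as the kernel of `s` grows, and `RhoAt` can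
only grow as the image shrinks. Conversely, monotone families of this kind that agree at related
projections define a congruence (`ConData.toCon`).

Below `κ` the projections are equal, so the kernel and image families vary independently, which is
the product decomposition. Below `ρ` the kernel family is the least possible and only the image
family remains; it depends on the image of `s` alone and so lives on cross-sections. Below `λ` the
situation is dual, with partitions.

For a general congruence the remaining condition is that related projections carry the same two
relations. This is automatic when they have the same kernel and image. Otherwise a congruence `ξ` of
`𝒯_r` relates all maps of at most the larger rank to constants (`con_const_of_not_kerImEq`), and
this forces the part below `κ` to be full at those ranks (`restrictTr_le_fullSetoid`). Compatibility
thus means that `ξ` lies in the equivalence `fullSetoid`, a restatement of the inequality of ranks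
(`rankTr_le_rankKappa_iff`). Such inclusions survive joins, so the image is a sublattice and the
injective, meet-preserving map is a lattice morphism. -/

/-- An injective meet-preserving map whose range is closed under joins is a lattice morphism. -/
theorem IsLatticeMorphism.of_inf {L M : Type*} [Lattice L] [Lattice M] {f : L → M}
    (hinj : Function.Injective f) (hinf : ∀ x y, f (x ⊓ y) = f x ⊓ f y)
    (hsup : ∀ x y, f x ⊔ f y ∈ Set.range f) : IsLatticeMorphism f := by
  have hle : ∀ x y, f x ≤ f y ↔ x ≤ y := fun x y => by
    rw [← inf_eq_left, ← hinf, hinj.eq_iff, inf_eq_left]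
  refine ⟨hinf, fun x y => le_antisymm ?_ (sup_le ((hle _ _).2 le_sup_left)
    ((hle _ _).2 le_sup_right))⟩
  obtain ⟨z, hz⟩ := hsup x y
  rw [← hz]
  exact (hle _ _).2 (sup_le ((hle _ _).1 (hz ▸ le_sup_left)) ((hle _ _).1 (hz ▸ le_sup_right)))

/-- An equivalence containing two congruences contains their join. -/
theorem con_sup_le_setoid {S : Type*} [Mul S] {σ τ : Con S} {E : Setoid S}
    (hσ : σ.toSetoid ≤ E) (hτ : τ.toSetoid ≤ E) : (σ ⊔ τ).toSetoid ≤ E := by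
  -- The join of the underlying equivalences is already a congruence: its pullback along any
  -- translation contains both `σ` and `τ`, hence contains the join.
  let D : Setoid S := σ.toSetoid ⊔ τ.toSetoid
  have hl : ∀ z, D ≤ D.comap (z * ·) := fun z =>
    sup_le (fun x y h => (le_sup_left : σ.toSetoid ≤ D) (σ.mul (σ.refl z) h))
      (fun x y h => (le_sup_right : τ.toSetoid ≤ D) (τ.mul (τ.refl z) h))
  have hr : ∀ z, D ≤ D.comap (· * z) := fun z =>
    sup_le (fun x y h => (le_sup_left : σ.toSetoid ≤ D) (σ.mul h (σ.refl z)))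
      (fun x y h => (le_sup_right : τ.toSetoid ≤ D) (τ.mul h (τ.refl z)))
  let C : Con S := ⟨D, fun {w x y z} h k => D.trans' (hr y h) (hl x k)⟩
  have hC : σ ⊔ τ ≤ C := sup_le (fun {x y} h => (le_sup_left : σ.toSetoid ≤ D) h)
    (fun {x y} h => (le_sup_right : τ.toSetoid ≤ D) h)
  exact fun x y h => (sup_le hσ hτ : D ≤ E) (hC h)

/-! ### Factorisation of transformations -/

/-- The identity transformation. -/
def Transf.idn (Y : Type*) : Transf Y := fun y => y

theorem Transf.idn_mul {Y : Type*} (s : Transf Y) : Transf.idn Y * s = s := rfl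

theorem Transf.mul_idn {Y : Type*} (s : Transf Y) : s * Transf.idn Y = s := rfl

theorem Transf.exists_right_factor {Y : Type*} {s t : Transf Y}
    (h : ∀ i j, s i = s j → t i = t j) : ∃ u, t = s * u := by
  classical
  refine ⟨fun y => if h : ∃ i, s i = y then t h.choose else y, funext fun i => ?_⟩
  have hi : ∃ j, s j = s i := ⟨i, rfl⟩
  change t i = if h : ∃ j, s j = s i then t h.choose else s i
  rw [dif_pos hi]
  exact h _ _ hi.choose_spec.symm

theorem Transf.exists_left_factor {Y : Type*} {s t : Transf Y}
    (h : t.im ⊆ s.im) : ∃ u, t = u * s := by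
  choose u hu using fun y => h ⟨y, rfl⟩
  exact ⟨u, funext fun y => (hu y).symm⟩

/-! ### Coordinates on `P` -/

section

variable {X : Type*} {a : Transf X} {r : ℕ}

/-- The cross-sections of the whole family `A_1, …, A_r`. -/
abbrev Sec (α : Fin r ≃ a.im) := {c : Fin r → X // ∀ i, a (c i) = (α i).1}

/-- The maps `X → [r]` that send `a_i` to `i`. -/
abbrev Ret (α : Fin r ≃ a.im) := {k : X → Fin r // ∀ i, k (α i).1 = i}

theorem apply_enum (ha : IsIdempotentElem a) (α : Fin r ≃ a.im) (i : Fin r) :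
    a (α i).1 = (α i).1 := by
  obtain ⟨z, hz⟩ := (α i).2
  rw [← hz]
  exact idem_apply ha z

/-- The cross-section `im(a)`. -/
def sec (ha : IsIdempotentElem a) (α : Fin r ≃ a.im) : Sec α :=
  ⟨fun i => (α i).1, apply_enum ha α⟩

/-- The map sending the elements of `A_i` to `i`. -/
def ret (ha : IsIdempotentElem a) (α : Fin r ≃ a.im) : Ret α :=
  ⟨fun x => α.symm ⟨a x, x, rfl⟩, fun i => by
    rw [Equiv.symm_apply_eq]
    exact Subtype.ext (apply_enum ha α i)⟩

variable {α : Fin r ≃ a.im}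

theorem Sec.inj (c d : Sec α) {i j : Fin r} (h : c.1 i = d.1 j) : i = j :=
  α.injective (Subtype.ext (by rw [← c.2, ← d.2, h]))

theorem Ret.apply_sec (k : Ret α) (c : Sec α) (i : Fin r) : k.1 (a (c.1 i)) = i := by
  rw [c.2, k.2]

/-- The element `x ↦ c(t(k x))` of `P`. -/
def elt (k : Ret α) (t : Transf (Fin r)) (c : Sec α) : Reg a :=
  ⟨Variant.of a fun x => c.1 (t (k.1 x)), (isRegularElt_variant_iff _).2 ⟨fun x y h => by
      change a (c.1 _) = a (c.1 _) at h
      change c.1 _ = c.1 _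
      rw [c.2, c.2] at h
      rw [α.injective (Subtype.ext h)], fun x => by
      obtain ⟨z, hz⟩ := (α (k.1 x)).2
      refine ⟨z, ?_⟩
      change c.1 (t (k.1 (a z))) = c.1 (t (k.1 x))
      rw [show a z = (α (k.1 x)).1 from hz, k.2]⟩⟩

theorem elt_apply (k : Ret α) (t : Transf (Fin r)) (c : Sec α) (x : X) :
    (elt k t c).1.toTransf x = c.1 (t (k.1 x)) := rfl

theorem elt_mul (k l : Ret α) (s t : Transf (Fin r)) (c d : Sec α) :
    elt k s c * elt l t d = elt k (s * t) d :=
  reg_ext fun x => by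
    change d.1 (t (l.1 (a (c.1 (s (k.1 x)))))) = d.1 (t (s (k.1 x)))
    rw [Ret.apply_sec]

/-- This measures the redundancy of the coordinates. Applying `a` recovers the index of a section
value, and evaluation at `a_i` removes the retraction. -/
theorem elt_eq_iff {k l : Ret α} {s t : Transf (Fin r)} {c d : Sec α} :
    elt k s c = elt l t d ↔ s = t ∧ (∀ x, s (k.1 x) = s (l.1 x)) ∧ ∀ i, c.1 (s i) = d.1 (s i) := by
  constructor
  · intro h
    have h' : ∀ x, c.1 (s (k.1 x)) = d.1 (t (l.1 x)) := fun x =>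
      congrArg (fun f : Reg a => f.1.toTransf x) h
    have e : ∀ x, s (k.1 x) = t (l.1 x) := fun x => Sec.inj c d (h' x)
    have est : s = t := funext fun i => by simpa only [k.2, l.2] using e (α i).1
    subst est
    exact ⟨rfl, e, fun i => by simpa only [k.2, l.2] using h' (α i).1⟩
  · rintro ⟨rfl, hk, hc⟩
    exact reg_ext fun x => by rw [elt_apply, elt_apply, ← hk, hc]

/-- Regularity says that `a` is injective on the image of the element and that every value is
attained on `im(a)`. The first property yields the section, the second the retraction. -/
theorem exists_elt (ha : IsIdempotentElem a) (α : Fin r ≃ a.im) (f : Reg a) :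
    ∃ (k : Ret α) (t : Transf (Fin r)) (c : Sec α), f = elt k t c := by
  classical
  obtain ⟨h1, h2⟩ := (isRegularElt_variant_iff _).1 f.2
  have h3 : ∀ x, ∃ i, f.1.toTransf (α i).1 = f.1.toTransf x := fun x => by
    obtain ⟨w, hw⟩ := h2 x
    exact ⟨α.symm ⟨a w, w, rfl⟩, by rw [Equiv.apply_symm_apply]; exact hw⟩
  choose m hm using h3
  let k : Ret α := ⟨fun x => if h : x ∈ a.im then α.symm ⟨x, h⟩ else m x, fun i => by
    dsimp only
    rw [dif_pos (α i).2]
    exact α.symm_apply_apply i⟩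
  have hk : ∀ x, f.1.toTransf (α (k.1 x)).1 = f.1.toTransf x := fun x => by
    by_cases h : x ∈ a.im
    · simp only [k, dif_pos h, Equiv.apply_symm_apply]
    · simp only [k, dif_neg h, hm]
  let t : Transf (Fin r) := fun i => α.symm ⟨a (f.1.toTransf (α i).1), _, rfl⟩
  have ht : ∀ i, (α (t i)).1 = a (f.1.toTransf (α i).1) := fun i => by
    simp only [t, Equiv.apply_symm_apply]
  -- A class `A_j` that misses the image of `f` gets the default `a_j`. On the others the chosen
  -- preimage does not matter, by `h1`.
  let c : Sec α := ⟨fun j => if h : ∃ i, t i = j then f.1.toTransf (α h.choose).1 else (α j).1,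
    fun j => by
      dsimp only
      by_cases h : ∃ i, t i = j
      · rw [dif_pos h, ← ht, h.choose_spec]
      · rw [dif_neg h, apply_enum ha]⟩
  refine ⟨k, t, c, reg_ext fun x => ?_⟩
  have hx : ∃ i, t i = t (k.1 x) := ⟨_, rfl⟩
  rw [elt_apply]
  simp only [c, dif_pos hx]
  rw [← hk x]
  refine h1 _ _ ?_
  rw [← ht, ← ht, hx.choose_spec]

theorem kappa_elt (ha : IsIdempotentElem a) {k l : Ret α} {s t : Transf (Fin r)} {c d : Sec α} :
    kappa ha (elt k s c) (elt l t d) ↔ s = t := by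
  rw [kappa_apply]
  have hs : ∀ (c : Sec α) i, a (c.1 i) = (α i).1 := fun c i => c.2 i
  simp only [elt_apply, hs]
  constructor
  · intro h
    funext i
    have := h (α i).1
    rw [apply_enum ha, k.2, l.2] at this
    exact α.injective (Subtype.ext this)
  · rintro rfl x
    obtain ⟨i, hi⟩ := α.surjective ⟨a x, x, rfl⟩
    have : a x = (α i).1 := by rw [hi]
    rw [this, k.2, l.2]

theorem rho_elt (ha : IsIdempotentElem a) {k l : Ret α} {s t : Transf (Fin r)} {c d : Sec α} :
    rho ha (elt k s c) (elt l t d) ↔ s = t ∧ ∀ x, s (k.1 x) = s (l.1 x) := by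
  change kappa ha _ _ ∧ GreenR _ _ ↔ _
  rw [kappa_elt]
  refine and_congr_right ?_
  rintro rfl
  constructor
  · rintro ⟨-, h⟩ x
    -- The points `x` and `a_{k x}` have the same value under the first element, hence under every
    -- right multiple of it.
    have key : (elt l s d).1.toTransf x = (elt l s d).1.toTransf (α (k.1 x)).1 := by
      have e : (elt k s c).1.toTransf x = (elt k s c).1.toTransf (α (k.1 x)).1 := by
        rw [elt_apply, elt_apply, k.2]
      rcases h with h | ⟨g, h⟩
      · rw [h, e]
      · rw [h]
        change g.1.toTransf (a ((elt k s c).1.toTransf _)) = g.1.toTransf (a ((elt k s c).1.toTransf _))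
        rw [e]
    rw [elt_apply, elt_apply, l.2] at key
    exact (Sec.inj d d key).symm
  · intro h
    have e : ∀ c' : Sec α, elt k s c' = elt l s c' := fun c' => elt_eq_iff.2 ⟨rfl, h, fun _ => rfl⟩
    -- Right multiplication by an element with identity projection replaces just the image
    -- coordinate.
    exact ⟨Or.inr ⟨elt k (Transf.idn _) c, by rw [elt_mul, Transf.mul_idn, e]⟩,
      Or.inr ⟨elt k (Transf.idn _) d, by rw [elt_mul, Transf.mul_idn, e]⟩⟩

theorem lam_elt (ha : IsIdempotentElem a) {k l : Ret α} {s t : Transf (Fin r)} {c d : Sec α} :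
    lam ha (elt k s c) (elt l t d) ↔ s = t ∧ ∀ i, c.1 (s i) = d.1 (s i) := by
  change kappa ha _ _ ∧ GreenL _ _ ↔ _
  rw [kappa_elt]
  refine and_congr_right ?_
  rintro rfl
  constructor
  · rintro ⟨-, h⟩ i
    have key : ∃ x, (elt l s d).1.toTransf (α i).1 = (elt k s c).1.toTransf x := by
      rcases h with h | ⟨g, h⟩
      · exact ⟨_, by rw [h]⟩
      · exact ⟨_, by rw [h]; rfl⟩
    obtain ⟨x, hx⟩ := key
    rw [elt_apply, elt_apply, l.2] at hx
    rw [hx, Sec.inj d c hx]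
  · intro h
    have e : ∀ k' : Ret α, elt k' s c = elt k' s d := fun k' => elt_eq_iff.2 ⟨rfl, fun _ => rfl, h⟩
    exact ⟨Or.inr ⟨elt k (Transf.idn _) c, by rw [elt_mul, Transf.idn_mul, e]⟩,
      Or.inr ⟨elt l (Transf.idn _) d, by rw [elt_mul, Transf.idn_mul, e]⟩⟩

/-! ### Congruences in coordinates -/

theorem con_elt_right {σ : Con (Reg a)} {k l : Ret α} {s t : Transf (Fin r)} {c d : Sec α}
    (h : σ (elt k s c) (elt l t d)) (u : Transf (Fin r)) (e : Sec α) :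
    σ (elt k (s * u) e) (elt l (t * u) e) := by
  simpa only [elt_mul] using σ.mul h (σ.refl (elt k u e))

theorem con_elt_left {σ : Con (Reg a)} {k l : Ret α} {s t : Transf (Fin r)} {c d : Sec α}
    (h : σ (elt k s c) (elt l t d)) (m : Ret α) (u : Transf (Fin r)) :
    σ (elt m (u * s) c) (elt m (u * t) d) := by
  simpa only [elt_mul] using σ.mul (σ.refl (elt m u c)) h

/-- A congruence, restricted to elements with fixed projection and image. -/
def LamAt (ha : IsIdempotentElem a) (α : Fin r ≃ a.im) (σ : Con (Reg a)) (t : Transf (Fin r)) :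
    Setoid (Ret α) :=
  σ.toSetoid.comap fun k => elt k t (sec ha α)

/-- A congruence, restricted to elements with fixed projection and kernel. -/
def RhoAt (ha : IsIdempotentElem a) (α : Fin r ≃ a.im) (σ : Con (Reg a)) (t : Transf (Fin r)) :
    Setoid (Sec α) :=
  σ.toSetoid.comap fun c => elt (ret ha α) t c

/-- A larger kernel is reached by multiplying on the right, which leaves the retractions untouched.
Dually, `RhoAt.mono` reaches a smaller image by multiplying on the left. -/
theorem LamAt.mono {ha : IsIdempotentElem a} {σ : Con (Reg a)} {s t : Transf (Fin r)}
    (hst : ∀ i j, s i = s j → t i = t j) {k l : Ret α} (h : LamAt ha α σ s k l) :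
    LamAt ha α σ t k l := by
  obtain ⟨u, rfl⟩ := Transf.exists_right_factor hst
  exact con_elt_right h u _

theorem RhoAt.mono {ha : IsIdempotentElem a} {σ : Con (Reg a)} {s t : Transf (Fin r)}
    (hst : t.im ⊆ s.im) {c d : Sec α} (h : RhoAt ha α σ s c d) : RhoAt ha α σ t c d := by
  obtain ⟨u, rfl⟩ := Transf.exists_left_factor hst
  exact con_elt_left h _ u

theorem restrictTr_apply (ha : IsIdempotentElem a) (σ : Con (Reg a)) (s t : Transf (Fin r)) :
    restrictTr ha α σ s t ↔
      σ (elt (ret ha α) s (sec ha α)) (elt (ret ha α) t (sec ha α)) := Iff.rfl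

/-- Multipliers with identity projection reset the outer coordinates one at a time to the standard
`ret` and `sec`. Conversely, the three relations are chained by changing the section, then the
retraction, then the projection. -/
theorem con_elt_iff (ha : IsIdempotentElem a) (σ : Con (Reg a)) {k l : Ret α}
    {s t : Transf (Fin r)} {c d : Sec α} :
    σ (elt k s c) (elt l t d) ↔
      restrictTr ha α σ s t ∧ LamAt ha α σ s k l ∧ RhoAt ha α σ s c d := by
  rw [restrictTr_apply]
  constructor
  · intro h
    have hr : σ (elt k s (sec ha α)) (elt l t (sec ha α)) := con_elt_right h (Transf.idn _) _
    have hl : σ (elt (ret ha α) s c) (elt (ret ha α) t d) := con_elt_left h _ (Transf.idn _)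
    have hst : σ (elt (ret ha α) s (sec ha α)) (elt (ret ha α) t (sec ha α)) :=
      con_elt_left hr _ (Transf.idn _)
    exact ⟨hst, σ.trans hr (σ.symm (con_elt_left hst l (Transf.idn _))),
      σ.trans hl (σ.symm (con_elt_right hst (Transf.idn _) d))⟩
  · rintro ⟨hst, hl, hr⟩
    have h1 : σ (elt k s c) (elt k s d) := con_elt_left hr k (Transf.idn _)
    have h2 : σ (elt k s d) (elt l s d) := con_elt_right hl (Transf.idn _) d
    have h3 : σ (elt l s d) (elt l t d) :=
      con_elt_left (con_elt_right hst (Transf.idn _) d) l (Transf.idn _)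
    exact σ.trans h1 (σ.trans h2 h3)

theorem con_elt_iff_of_le_kappa (ha : IsIdempotentElem a) {θ : Con (Reg a)} (hθ : θ ≤ kappa ha)
    {k l : Ret α} {s t : Transf (Fin r)} {c d : Sec α} :
    θ (elt k s c) (elt l t d) ↔ s = t ∧ LamAt ha α θ s k l ∧ RhoAt ha α θ s c d := by
  rw [con_elt_iff ha]
  refine and_congr_left fun _ => ⟨fun h => (kappa_elt ha).1 (hθ ((restrictTr_apply ha θ s t).1 h)), ?_⟩
  rintro rfl
  exact (restrictTr ha α θ).refl s

theorem con_ext_elt (ha : IsIdempotentElem a) (α : Fin r ≃ a.im) {σ τ : Con (Reg a)}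
    (h : ∀ (k l : Ret α) (s t : Transf (Fin r)) (c d : Sec α),
      σ (elt k s c) (elt l t d) ↔ τ (elt k s c) (elt l t d)) : σ = τ := by
  refine Con.ext fun f g => ?_
  obtain ⟨k, s, c, rfl⟩ := exists_elt ha α f
  obtain ⟨l, t, d, rfl⟩ := exists_elt ha α g
  exact h _ _ _ _ _ _

end

/-! ### Gluing congruences from kernel and image relations; the interval below `κ` -/

section

variable {X : Type*} {a : Transf X} {r : ℕ} {α : Fin r ≃ a.im}

theorem lamAt_of_forall_eq (ha : IsIdempotentElem a) (σ : Con (Reg a)) {s : Transf (Fin r)}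
    {k l : Ret α} (h : ∀ x, s (k.1 x) = s (l.1 x)) : LamAt ha α σ s k l := by
  have e : elt k s (sec ha α) = elt l s (sec ha α) := elt_eq_iff.2 ⟨rfl, h, fun _ => rfl⟩
  change σ (elt k s (sec ha α)) (elt l s (sec ha α))
  rw [e]
  exact σ.refl _

theorem rhoAt_of_forall_eq (ha : IsIdempotentElem a) (σ : Con (Reg a)) {s : Transf (Fin r)}
    {c d : Sec α} (h : ∀ i, c.1 (s i) = d.1 (s i)) : RhoAt ha α σ s c d := by
  have e : elt (ret ha α) s c = elt (ret ha α) s d := elt_eq_iff.2 ⟨rfl, fun _ => rfl, h⟩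
  change σ (elt (ret ha α) s c) (elt (ret ha α) s d)
  rw [e]
  exact σ.refl _

variable (α) in
/-- Compatible data describing a congruence of `P` in coordinates. -/
structure ConData where
  /-- the relation between projections -/
  proj : Con (Transf (Fin r))
  /-- the relations between kernels -/
  ker : Transf (Fin r) → Setoid (Ret α)
  /-- the relations between images -/
  img : Transf (Fin r) → Setoid (Sec α)
  ker_of_eq : ∀ s (k l : Ret α), (∀ x, s (k.1 x) = s (l.1 x)) → ker s k l
  img_of_eq : ∀ s (c d : Sec α), (∀ i, c.1 (s i) = d.1 (s i)) → img s c d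
  ker_mul : ∀ s u, ker s ≤ ker (s * u)
  img_mul : ∀ u s, img s ≤ img (u * s)
  ker_congr : ∀ s t, proj s t → ker s = ker t
  img_congr : ∀ s t, proj s t → img s = img t

/-- The relation on `P` described by `D`. -/
def ConData.Rel (D : ConData α) (f g : Reg a) : Prop :=
  ∃ (k l : Ret α) (s t : Transf (Fin r)) (c d : Sec α),
    f = elt k s c ∧ g = elt l t d ∧ D.proj s t ∧ D.ker s k l ∧ D.img s c d

/-- The coordinates in `Rel` are existentially quantified and not unique. The fields `ker_of_eq` and
`img_of_eq` absorb a change of coordinates on the first element; the fields `ker_congr` and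
`img_congr` move the change on the second element from `t` to `s`. -/
theorem ConData.rel_elt (D : ConData α) {k l : Ret α} {s t : Transf (Fin r)} {c d : Sec α} :
    D.Rel (elt k s c) (elt l t d) ↔ D.proj s t ∧ D.ker s k l ∧ D.img s c d := by
  refine ⟨?_, fun h => ⟨_, _, _, _, _, _, rfl, rfl, h⟩⟩
  rintro ⟨k', l', s', t', c', d', hf, hg, hst, hk, hc⟩
  obtain ⟨rfl, hkk, hcc⟩ := elt_eq_iff.1 hf
  obtain ⟨rfl, hll, hdd⟩ := elt_eq_iff.1 hg
  refine ⟨hst, (D.ker s).trans' (D.ker_of_eq _ _ _ hkk) ((D.ker s).trans' hk ?_),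
    (D.img s).trans' (D.img_of_eq _ _ _ hcc) ((D.img s).trans' hc ?_)⟩
  · rw [D.ker_congr _ _ hst]
    exact (D.ker t).symm' (D.ker_of_eq _ _ _ hll)
  · rw [D.img_congr _ _ hst]
    exact (D.img t).symm' (D.img_of_eq _ _ _ hdd)

/-- The congruence of `P` described by `D`. -/
def ConData.toCon (D : ConData α) (ha : IsIdempotentElem a) : Con (Reg a) where
  r := D.Rel
  iseqv := by
    refine ⟨fun f => ?_, fun {f g} => ?_, fun {f g h} => ?_⟩
    · obtain ⟨k, s, c, rfl⟩ := exists_elt ha α f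
      exact D.rel_elt.2 ⟨D.proj.refl _, (D.ker s).refl' _, (D.img s).refl' _⟩
    · obtain ⟨k, s, c, rfl⟩ := exists_elt ha α f
      obtain ⟨l, t, d, rfl⟩ := exists_elt ha α g
      rw [D.rel_elt, D.rel_elt]
      rintro ⟨h1, h2, h3⟩
      rw [D.ker_congr _ _ h1] at h2
      rw [D.img_congr _ _ h1] at h3
      exact ⟨D.proj.symm h1, (D.ker t).symm' h2, (D.img t).symm' h3⟩
    · obtain ⟨k, s, c, rfl⟩ := exists_elt ha α f
      obtain ⟨l, t, d, rfl⟩ := exists_elt ha α g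
      obtain ⟨m, u, e, rfl⟩ := exists_elt ha α h
      rw [D.rel_elt, D.rel_elt, D.rel_elt]
      rintro ⟨h1, h2, h3⟩ ⟨h4, h5, h6⟩
      rw [← D.ker_congr _ _ h1] at h5
      rw [← D.img_congr _ _ h1] at h6
      exact ⟨D.proj.trans h1 h4, (D.ker s).trans' h2 h5, (D.img s).trans' h3 h6⟩
  mul' := by
    intro f g f' g'
    obtain ⟨k, s, c, rfl⟩ := exists_elt ha α f
    obtain ⟨l, t, d, rfl⟩ := exists_elt ha α g
    obtain ⟨k', s', c', rfl⟩ := exists_elt ha α f'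
    obtain ⟨l', t', d', rfl⟩ := exists_elt ha α g'
    rw [elt_mul, elt_mul, D.rel_elt, D.rel_elt, D.rel_elt]
    exact fun h h' => ⟨D.proj.mul h.1 h'.1, D.ker_mul _ _ h.2.1, D.img_mul _ _ h'.2.2⟩

theorem ConData.toCon_elt (D : ConData α) (ha : IsIdempotentElem a) {k l : Ret α}
    {s t : Transf (Fin r)} {c d : Sec α} :
    D.toCon ha (elt k s c) (elt l t d) ↔ D.proj s t ∧ D.ker s k l ∧ D.img s c d :=
  D.rel_elt

theorem ConData.lamAt_toCon (D : ConData α) (ha : IsIdempotentElem a) (s : Transf (Fin r)) :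
    LamAt ha α (D.toCon ha) s = D.ker s :=
  Setoid.ext fun _ _ => (D.toCon_elt ha).trans
    ⟨fun h => h.2.1, fun h => ⟨D.proj.refl _, h, (D.img s).refl' _⟩⟩

theorem ConData.rhoAt_toCon (D : ConData α) (ha : IsIdempotentElem a) (s : Transf (Fin r)) :
    RhoAt ha α (D.toCon ha) s = D.img s :=
  Setoid.ext fun _ _ => (D.toCon_elt ha).trans
    ⟨fun h => h.2.2, fun h => ⟨D.proj.refl _, (D.ker s).refl' _, h⟩⟩

theorem lamAt_inf (ha : IsIdempotentElem a) (σ τ : Con (Reg a)) (s : Transf (Fin r)) :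
    LamAt ha α (σ ⊓ τ) s = LamAt ha α σ s ⊓ LamAt ha α τ s := rfl

theorem rhoAt_inf (ha : IsIdempotentElem a) (σ τ : Con (Reg a)) (s : Transf (Fin r)) :
    RhoAt ha α (σ ⊓ τ) s = RhoAt ha α σ s ⊓ RhoAt ha α τ s := rfl

theorem lamAt_kappa (ha : IsIdempotentElem a) (s : Transf (Fin r)) :
    LamAt ha α (kappa ha) s = ⊤ :=
  Setoid.ext fun _ _ => ⟨fun _ => trivial, fun _ => (kappa_elt ha).2 rfl⟩

theorem rhoAt_kappa (ha : IsIdempotentElem a) (s : Transf (Fin r)) :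
    RhoAt ha α (kappa ha) s = ⊤ :=
  Setoid.ext fun _ _ => ⟨fun _ => trivial, fun _ => (kappa_elt ha).2 rfl⟩

theorem lamAt_lam (ha : IsIdempotentElem a) (s : Transf (Fin r)) :
    LamAt ha α (lam ha) s = ⊤ :=
  Setoid.ext fun _ _ => ⟨fun _ => trivial, fun _ => (lam_elt ha).2 ⟨rfl, fun _ => rfl⟩⟩

theorem rhoAt_rho (ha : IsIdempotentElem a) (s : Transf (Fin r)) :
    RhoAt ha α (rho ha) s = ⊤ :=
  Setoid.ext fun _ _ => ⟨fun _ => trivial, fun _ => (rho_elt ha).2 ⟨rfl, fun _ => rfl⟩⟩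

theorem lam_le_kappa (ha : IsIdempotentElem a) : lam ha ≤ kappa ha := fun {_ _} h => h.1

theorem rho_le_kappa (ha : IsIdempotentElem a) : rho ha ≤ kappa ha := fun {_ _} h => h.1

/-- A congruence below `κ` is determined by its restrictions to kernels and images. -/
theorem con_ext_of_le_kappa (ha : IsIdempotentElem a) {θ η : Con (Reg a)} (hθ : θ ≤ kappa ha)
    (hη : η ≤ kappa ha) (hl : ∀ s, LamAt ha α θ s = LamAt ha α η s)
    (hr : ∀ s, RhoAt ha α θ s = RhoAt ha α η s) : θ = η :=
  con_ext_elt ha α fun k l s t c d => by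
    rw [con_elt_iff_of_le_kappa ha hθ, con_elt_iff_of_le_kappa ha hη, hl, hr]

/-- A congruence below `κ` with prescribed restrictions to kernels and images. -/
theorem exists_con_le_kappa (ha : IsIdempotentElem a) (K : Transf (Fin r) → Setoid (Ret α))
    (C : Transf (Fin r) → Setoid (Sec α))
    (hK : ∀ s (k l : Ret α), (∀ x, s (k.1 x) = s (l.1 x)) → K s k l)
    (hC : ∀ s (c d : Sec α), (∀ i, c.1 (s i) = d.1 (s i)) → C s c d)
    (hKm : ∀ s u, K s ≤ K (s * u)) (hCm : ∀ u s, C s ≤ C (u * s)) :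
    ∃ θ ≤ kappa ha, (∀ s, LamAt ha α θ s = K s) ∧ ∀ s, RhoAt ha α θ s = C s := by
  let D : ConData α := ⟨⊥, K, C, hK, hC, hKm, hCm, fun _ _ h => congrArg K h,
    fun _ _ h => congrArg C h⟩
  refine ⟨D.toCon ha, ?_, D.lamAt_toCon ha, D.rhoAt_toCon ha⟩
  intro f g
  obtain ⟨k, s, c, rfl⟩ := exists_elt ha α f
  obtain ⟨l, t, d, rfl⟩ := exists_elt ha α g
  intro h
  exact (kappa_elt ha).2 ((D.toCon_elt ha).1 h).1

theorem LamAt.le_mul (ha : IsIdempotentElem a) (σ : Con (Reg a)) (s u : Transf (Fin r)) :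
    LamAt ha α σ s ≤ LamAt ha α σ (s * u) :=
  fun _ _ h => con_elt_right h u _

theorem RhoAt.le_mul (ha : IsIdempotentElem a) (σ : Con (Reg a)) (u s : Transf (Fin r)) :
    RhoAt ha α σ s ≤ RhoAt ha α σ (u * s) :=
  fun _ _ h => con_elt_left h _ u

/-- The kernel relations of a congruence below `ρ` are trivial. -/
theorem lamAt_of_le_rho (ha : IsIdempotentElem a) {θ : Con (Reg a)} (hθ : θ ≤ rho ha)
    (s : Transf (Fin r)) : LamAt ha α θ s = LamAt ha α (rho ha) s :=
  Setoid.ext fun _ _ => ⟨fun h => hθ h, fun h => lamAt_of_forall_eq ha θ ((rho_elt ha).1 h).2⟩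

/-- The image relations of a congruence below `λ` are trivial. -/
theorem rhoAt_of_le_lam (ha : IsIdempotentElem a) {θ : Con (Reg a)} (hθ : θ ≤ lam ha)
    (s : Transf (Fin r)) : RhoAt ha α θ s = RhoAt ha α (lam ha) s :=
  Setoid.ext fun _ _ => ⟨fun h => hθ h, fun h => rhoAt_of_forall_eq ha θ ((lam_elt ha).1 h).2⟩

theorem con_ext_of_le_rho (ha : IsIdempotentElem a) {θ η : Con (Reg a)} (hθ : θ ≤ rho ha)
    (hη : η ≤ rho ha) (hr : ∀ s, RhoAt ha α θ s = RhoAt ha α η s) : θ = η :=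
  con_ext_of_le_kappa ha (hθ.trans (rho_le_kappa ha)) (hη.trans (rho_le_kappa ha))
    (fun s => by rw [lamAt_of_le_rho ha hθ, lamAt_of_le_rho ha hη]) hr

theorem con_ext_of_le_lam (ha : IsIdempotentElem a) {θ η : Con (Reg a)} (hθ : θ ≤ lam ha)
    (hη : η ≤ lam ha) (hl : ∀ s, LamAt ha α θ s = LamAt ha α η s) : θ = η :=
  con_ext_of_le_kappa ha (hθ.trans (lam_le_kappa ha)) (hη.trans (lam_le_kappa ha)) hl
    (fun s => by rw [rhoAt_of_le_lam ha hθ, rhoAt_of_le_lam ha hη])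

/-- Meeting with `λ` keeps the kernel relations and trivialises the image relations; meeting with
`ρ` does the opposite. A preimage takes its kernel relations from one component and its image
relations from the other. -/
theorem kappaMap_isLatticeIso (ha : IsIdempotentElem a) (α : Fin r ≃ a.im) :
    IsLatticeIso (kappaMap ha) := by
  have hinj : Function.Injective (kappaMap ha) := by
    rintro ⟨θ, _, hθ⟩ ⟨η, _, hη⟩ hθη
    have hl : θ ⊓ lam ha = η ⊓ lam ha := congrArg Subtype.val (congrArg Prod.fst hθη)
    have hr : θ ⊓ rho ha = η ⊓ rho ha := congrArg Subtype.val (congrArg Prod.snd hθη)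
    refine Subtype.ext (con_ext_of_le_kappa ha (α := α) hθ hη (fun s => ?_) fun s => ?_)
    · have := congrArg (fun τ => LamAt ha α τ s) hl
      simpa only [lamAt_inf, lamAt_lam, inf_top_eq] using this
    · have := congrArg (fun τ => RhoAt ha α τ s) hr
      simpa only [rhoAt_inf, rhoAt_rho, inf_top_eq] using this
  have hsurj : Function.Surjective (kappaMap ha) := by
    rintro ⟨⟨θ, _, hθ⟩, ⟨η, _, hη⟩⟩
    obtain ⟨τ, hτ, hl, hr⟩ := exists_con_le_kappa ha (LamAt ha α θ) (RhoAt ha α η)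
      (fun _ _ _ => lamAt_of_forall_eq ha θ) (fun _ _ _ => rhoAt_of_forall_eq ha η)
      (LamAt.le_mul ha θ) (RhoAt.le_mul ha η)
    refine ⟨⟨τ, bot_le, hτ⟩, Prod.ext (Subtype.ext ?_) (Subtype.ext ?_)⟩
    · refine con_ext_of_le_lam (α := α) ha inf_le_right hθ fun s => ?_
      change LamAt ha α (τ ⊓ lam ha) s = LamAt ha α θ s
      rw [lamAt_inf, lamAt_lam, inf_top_eq, hl]
    · refine con_ext_of_le_rho (α := α) ha inf_le_right hη fun s => ?_
      change RhoAt ha α (τ ⊓ rho ha) s = RhoAt ha α η s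
      rw [rhoAt_inf, rhoAt_rho, inf_top_eq, hr]
  refine ⟨.of_inf hinj (fun θ η => ?_) fun _ _ => hsurj _, hinj, hsurj⟩
  exact Prod.ext (Subtype.ext (inf_inf_distrib_right ..)) (Subtype.ext (inf_inf_distrib_right ..))

end

/-! ### Congruences of a full transformation semigroup -/

section

variable {Y : Type*}

/-- The constant transformation. -/
def Transf.const (y : Y) : Transf Y := fun _ => y

/-- Two transformations have the same kernel and the same image. -/
def KerImEq (s t : Transf Y) : Prop := (∀ i j, s i = s j ↔ t i = t j) ∧ s.im = t.im

theorem KerImEq.symm {s t : Transf Y} (h : KerImEq s t) : KerImEq t s :=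
  ⟨fun i j => (h.1 i j).symm, h.2.symm⟩

theorem KerImEq.trans {s t u : Transf Y} (h : KerImEq s t) (k : KerImEq t u) : KerImEq s u :=
  ⟨fun i j => (h.1 i j).trans (k.1 i j), h.2.trans k.2⟩

theorem Transf.im_const [Nonempty Y] (y : Y) : (Transf.const y).im = {y} := Set.range_const

theorem Transf.rank_const [Nonempty Y] (y : Y) : (Transf.const y).rank = 1 := by
  rw [Transf.rank, Transf.im_const, Set.ncard_singleton]

/-- Two constants have different images, so `s` cannot match both. The constant obtained serves as a
partner of `s` that excludes the first alternative in `fullSetoid`. -/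
theorem exists_const_not_kerImEq [Nontrivial Y] (s : Transf Y) :
    ∃ z, ¬KerImEq s (Transf.const z) := by
  obtain ⟨y, z, hyz⟩ := exists_pair_ne Y
  by_contra! h
  have e := (h y).2.symm.trans (h z).2
  rw [Transf.im_const, Transf.im_const, Set.singleton_eq_singleton_iff] at e
  exact hyz e

theorem Transf.im_mul (s t : Transf Y) : (s * t).im = t '' s.im := Set.range_comp t s

variable {ξ : Con (Transf Y)} {s t : Transf Y}

/-- At a point `i` where the maps differ, precomposing with the constant `i` and postcomposing with
a map that separates the two values yields any prescribed pair of constants. -/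
theorem con_const_of_ne (h : ξ s t) (hne : s ≠ t) (y z : Y) :
    ξ (Transf.const y) (Transf.const z) := by
  classical
  obtain ⟨i, hi⟩ := Function.ne_iff.1 hne
  let u : Transf Y := fun j => if j = s i then y else z
  have := ξ.mul (ξ.mul (ξ.refl (Transf.const i)) h) (ξ.refl u)
  have e1 : Transf.const i * s * u = Transf.const y := funext fun _ => if_pos rfl
  have e2 : Transf.const i * t * u = Transf.const z := funext fun _ => if_neg (Ne.symm hi)
  rwa [e1, e2] at this

variable [Finite Y]

theorem Transf.rank_mul_le_left (s t : Transf Y) : (s * t).rank ≤ s.rank := by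
  rw [Transf.rank, Transf.im_mul]
  exact Set.ncard_image_le

theorem Transf.rank_pos [Nonempty Y] (s : Transf Y) : 0 < s.rank :=
  (Set.ncard_pos).2 (Set.range_nonempty _)

theorem Transf.eq_const_of_rank_le_one [Nonempty Y] {s : Transf Y} (h : s.rank ≤ 1) :
    ∃ y, s = Transf.const y := by
  obtain ⟨y, hy⟩ := Set.ncard_eq_one.1 (le_antisymm h s.rank_pos)
  exact ⟨y, funext fun i => hy.subset ⟨i, rfl⟩⟩

theorem Transf.rank_le_of_ker_le (h : ∀ i j, s i = s j → t i = t j) : t.rank ≤ s.rank := by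
  obtain ⟨w, rfl⟩ := Transf.exists_right_factor h
  exact Transf.rank_mul_le_left _ _

/-- Otherwise the kernel of `t` lies in that of `s`, so `s = t * w`; the rank inequality makes `w`
injective on the image of `t`, and the kernels agree. -/
theorem exists_collapse_of_rank_le (hle : t.rank ≤ s.rank)
    (hker : ¬∀ i j, s i = s j ↔ t i = t j) : ∃ x y, s x ≠ s y ∧ t x = t y := by
  by_contra! hcon
  have hts : ∀ i j, t i = t j → s i = s j := fun i j e => by
    by_contra hne
    exact hcon i j hne e
  obtain ⟨w, hw⟩ := Transf.exists_right_factor hts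
  have him : s.im = w '' t.im := by
    conv_lhs => rw [hw]
    exact Transf.im_mul t w
  have hinj : Set.InjOn w t.im := by
    refine Set.injOn_of_ncard_image_eq (le_antisymm Set.ncard_image_le ?_)
    rw [← him]
    exact hle
  refine hker fun i j => ⟨fun e => hinj ⟨i, rfl⟩ ⟨j, rfl⟩ ?_, hts i j⟩
  have hs : ∀ i, s i = w (t i) := fun i => congrFun hw i
  exact (hs i).symm.trans (e.trans (hs j))

variable [Nonempty Y]

/-- If a congruence relates `s` to some `t` identifying two points which `s` separates, then it
lowers the rank of all elements of rank at least two and at most `rank s`. -/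
theorem exists_con_rank_lt (h : ξ s t) {x y : Y} (hs : s x ≠ s y) (ht : t x = t y) {u : Transf Y}
    (hu2 : 2 ≤ u.rank) (hu : u.rank ≤ s.rank) : ∃ v, ξ u v ∧ v.rank < u.rank := by
  have hxy : x ≠ y := fun e => hs (by rw [e])
  have hpair : Set.InjOn s {x, y} := by
    exact Set.injOn_pair.2 fun e => absurd e hs
  -- `A` is a transversal of the kernel of `s` through `x` and `y`. It is cut down to a set `B` of
  -- size `u.rank` that still contains both, which needs rank at least two.
  obtain ⟨A, hxyA, -, hA, hinj⟩ := hpair.exists_subset_injOn_subset_range_eq (Set.subset_univ _)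
  have hcard : A.ncard = s.rank := by
    rw [← hinj.ncard_image, hA]
    exact congrArg Set.ncard Set.image_univ
  obtain ⟨B, hxyB, hBA, hB⟩ := Set.exists_subsuperset_card_eq (n := u.rank) hxyA
    (by rwa [Set.ncard_pair hxy]) (by rwa [hcard])
  have hBinj := hinj.mono hBA
  obtain ⟨j, hj⟩ := (Set.toFinite u.im).exists_bijOn_of_encard_eq (t := B) (by
    rw [← (Set.toFinite u.im).cast_ncard_eq, ← (Set.toFinite B).cast_ncard_eq, hB]
    rfl)
  let p : Transf Y := fun i => j (u i)
  have hp : p.im = B := by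
    have : p.im = j '' u.im := Set.range_comp j u
    rw [this, hj.image_eq]
  have hpB : ∀ i, p i ∈ B := fun i => hp ▸ ⟨i, rfl⟩
  -- The map `p` has the kernel of `u` and image `B`, on which `s` is injective, so `u = p * s * q`.
  -- Replacing `s` by `t` loses rank because `t` identifies `x` and `y`.
  obtain ⟨q, hq⟩ := Transf.exists_right_factor (s := p * s) (t := u) fun i i' e =>
    hj.injOn ⟨i, rfl⟩ ⟨i', rfl⟩ (hBinj (hpB i) (hpB i') e)
  refine ⟨p * t * q, ?_, ?_⟩
  · have := ξ.mul (ξ.mul (ξ.refl p) h) (ξ.refl q)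
    rwa [← hq] at this
  · refine (Transf.rank_mul_le_left _ _).trans_lt ?_
    rw [Transf.rank, Transf.im_mul, hp, ← hB]
    refine lt_of_le_of_ne Set.ncard_image_le fun e => hxy ?_
    exact Set.injOn_of_ncard_image_eq e (Set.toFinite B) (hxyB (Set.mem_insert x {y}))
      (hxyB (Set.mem_insert_of_mem x rfl)) ht

/-- Descent on the rank of `u`: the previous lemma lowers it until a constant is reached, and all
constants are related. -/
theorem con_const_of_collapse (h : ξ s t) {x y : Y} (hs : s x ≠ s y) (ht : t x = t y)
    (u : Transf Y) (hu : u.rank ≤ s.rank) (z : Y) : ξ u (Transf.const z) := by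
  induction hk : u.rank using Nat.strong_induction_on generalizing u with
  | _ k ih =>
    subst hk
    by_cases hu2 : 2 ≤ u.rank
    · obtain ⟨v, huv, hv⟩ := exists_con_rank_lt h hs ht hu2 hu
      exact ξ.trans huv (ih _ hv v (hv.le.trans hu) rfl)
    · obtain ⟨w, rfl⟩ := Transf.eq_const_of_rank_le_one (s := u) (by omega)
      exact con_const_of_ne h (fun e => hs (by rw [e, ht])) w z

theorem con_const_of_ker_ne (h : ξ s t) (hker : ¬∀ i j, s i = s j ↔ t i = t j) (u : Transf Y)
    (hu : u.rank ≤ max s.rank t.rank) (z : Y) : ξ u (Transf.const z) := by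
  rcases le_total t.rank s.rank with hle | hle
  · obtain ⟨x, y, hs, ht⟩ := exists_collapse_of_rank_le hle hker
    exact con_const_of_collapse h hs ht u (by rwa [max_eq_left hle] at hu) z
  · obtain ⟨x, y, ht, hs⟩ := exists_collapse_of_rank_le hle fun e => hker fun i j => (e i j).symm
    exact con_const_of_collapse (ξ.symm h) ht hs u (by rwa [max_eq_right hle] at hu) z

/-- A congruence relating two elements with different kernels or images relates all elements of at
most the larger of their ranks. -/
theorem con_const_of_not_kerImEq (h : ξ s t) (hH : ¬KerImEq s t) (u : Transf Y)
    (hu : u.rank ≤ max s.rank t.rank) (z : Y) : ξ u (Transf.const z) := by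
  classical
  by_cases hker : ∀ i j, s i = s j ↔ t i = t j
  · have him : s.im ≠ t.im := fun e => hH ⟨hker, e⟩
    have hrank : s.rank = t.rank := le_antisymm
      (Transf.rank_le_of_ker_le fun i j => (hker i j).2)
      (Transf.rank_le_of_ker_le fun i j => (hker i j).1)
    rw [hrank, max_self] at hu
    have hx : ∃ x, s x ∉ t.im := by
      by_contra! hsub
      refine him (Set.eq_of_subset_of_ncard_le ?_ hrank.ge)
      rintro _ ⟨x, rfl⟩
      exact hsub x
    obtain ⟨x, hx⟩ := hx
    by_cases hx' : ∃ y, s y ≠ s x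
    · obtain ⟨y, hy⟩ := hx'
      -- `w` moves the value `s x`, missing from the image of `t`, onto another value of `s`. It
      -- fixes `t` but makes `s` collapse `x` and `y`, which `t` separates.
      let w : Transf Y := fun i => if i = s x then s y else i
      have htw : t * w = t := funext fun i => if_neg fun e => hx ⟨i, e⟩
      have hsw : (s * w) x = (s * w) y := by
        change (if s x = s x then s y else s x) = if s y = s x then s y else s y
        rw [if_pos rfl, ite_self]
      have hrel : ξ t (s * w) := by
        have := ξ.mul (ξ.symm h) (ξ.refl w)
        rwa [htw] at this
      exact con_const_of_collapse hrel (fun e => hy ((hker _ _).2 e).symm) hsw u hu z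
    · push Not at hx'
      have ht1 : t.rank ≤ 1 := by
        have e : s = Transf.const (s x) := funext hx'
        rw [← hrank, e, Transf.rank_const]
      obtain ⟨w, rfl⟩ := Transf.eq_const_of_rank_le_one (hu.trans ht1)
      exact con_const_of_ne h (fun e => him (by rw [e])) w z
  · exact con_const_of_ker_ne h hker u hu z

end

/-! ### Congruences of `P` from compatible pairs -/

section

variable {X : Type*} {a : Transf X} {r : ℕ} {α : Fin r ≃ a.im}

theorem im_elt (k : Ret α) (s : Transf (Fin r)) (c : Sec α) :
    (elt k s c).1.toTransf.im = c.1 '' s.im := by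
  ext y
  constructor
  · rintro ⟨x, rfl⟩
    exact ⟨_, ⟨k.1 x, rfl⟩, rfl⟩
  · rintro ⟨_, ⟨i, rfl⟩, rfl⟩
    refine ⟨(α i).1, ?_⟩
    change c.1 (s (k.1 (α i).1)) = _
    rw [k.2]

theorem rank_elt (k : Ret α) (s : Transf (Fin r)) (c : Sec α) :
    (elt k s c).1.toTransf.rank = s.rank := by
  rw [Transf.rank, im_elt, Set.ncard_image_of_injective _ fun i j h => Sec.inj c c h]
  rfl

variable (α) in
/-- The congruence `θ` contains the restriction of `κ` to elements projecting to `s`. -/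
def FullAt (ha : IsIdempotentElem a) (θ : Con (Reg a)) (s : Transf (Fin r)) : Prop :=
  LamAt ha α θ s = ⊤ ∧ RhoAt ha α θ s = ⊤

theorem FullAt.mono {ha : IsIdempotentElem a} {θ η : Con (Reg a)} (hle : θ ≤ η)
    {s : Transf (Fin r)} (h : FullAt α ha θ s) : FullAt α ha η s :=
  ⟨top_unique (h.1.ge.trans fun _ _ e => hle e), top_unique (h.2.ge.trans fun _ _ e => hle e)⟩

/-- Fullness at `s` depends only on the kernel and image of `s`, by monotonicity; this makes
`fullSetoid` transitive. -/
theorem FullAt.of_kerImEq {ha : IsIdempotentElem a} {θ : Con (Reg a)} {s t : Transf (Fin r)}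
    (h : FullAt α ha θ s) (e : KerImEq s t) : FullAt α ha θ t :=
  ⟨top_unique (h.1.ge.trans fun _ _ => LamAt.mono fun i j => (e.1 i j).1),
    top_unique (h.2.ge.trans fun _ _ => RhoAt.mono e.2.ge)⟩

variable (α) in
/-- The relation that `s`, `t` have the same kernel and image, or `θ` is full at both. -/
def fullSetoid (ha : IsIdempotentElem a) (θ : Con (Reg a)) : Setoid (Transf (Fin r)) where
  r s t := KerImEq s t ∨ FullAt α ha θ s ∧ FullAt α ha θ t
  iseqv := by
    refine ⟨fun s => Or.inl ⟨fun _ _ => Iff.rfl, rfl⟩, ?_, ?_⟩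
    · rintro s t (h | h)
      · exact Or.inl h.symm
      · exact Or.inr h.symm
    · rintro s t u (h | h) (k | k)
      · exact Or.inl (h.trans k)
      · exact Or.inr ⟨k.1.of_kerImEq h.symm, k.2⟩
      · exact Or.inr ⟨h.1, h.2.of_kerImEq k⟩
      · exact Or.inr ⟨h.1, k.2⟩

theorem fullSetoid_mono {ha : IsIdempotentElem a} {θ η : Con (Reg a)} (hle : θ ≤ η) :
    fullSetoid α ha θ ≤ fullSetoid α ha η := by
  rintro s t (h | h)
  · exact Or.inl h
  · exact Or.inr ⟨h.1.mono hle, h.2.mono hle⟩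

theorem lamAt_eq_of_fullSetoid {ha : IsIdempotentElem a} {θ : Con (Reg a)} {s t : Transf (Fin r)}
    (h : fullSetoid α ha θ s t) : LamAt ha α θ s = LamAt ha α θ t := by
  rcases h with h | h
  · exact le_antisymm (fun _ _ => LamAt.mono fun i j => (h.1 i j).1)
      (fun _ _ => LamAt.mono fun i j => (h.1 i j).2)
  · rw [h.1.1, h.2.1]

theorem rhoAt_eq_of_fullSetoid {ha : IsIdempotentElem a} {θ : Con (Reg a)} {s t : Transf (Fin r)}
    (h : fullSetoid α ha θ s t) : RhoAt ha α θ s = RhoAt ha α θ t := by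
  rcases h with h | h
  · exact le_antisymm (fun _ _ => RhoAt.mono h.2.ge) (fun _ _ => RhoAt.mono h.2.le)
  · rw [h.1.2, h.2.2]

/-- Inclusion in an equivalence that is monotone in `θ` is stable under joins, which is not visible
from the inequality. A related pair with different kernels or images pushes the rank of `ξ` up to
the larger of their ranks; conversely, each map of rank at most the rank of `ξ` is related to a
constant with a different kernel or image. -/
theorem rankTr_le_rankKappa_iff (ha : IsIdempotentElem a) (hr : 2 ≤ r) (hrank : a.rank = r)
    {ξ : Con (Transf (Fin r))} {θ : Con (Reg a)} :
    rankTr ξ ≤ rankKappa ha θ ↔ ξ.toSetoid ≤ fullSetoid α ha θ := by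
  classical
  have : Nontrivial (Fin r) := Fin.nontrivial_iff_two_le.2 hr
  constructor
  · intro hle s t hst
    by_cases hH : KerImEq s t
    · exact Or.inl hH
    right
    set q := max s.rank t.rank with hq
    have hbound : ∀ u : Transf (Fin r), u.rank ≤ r := fun u =>
      (Set.ncard_le_card _).trans_eq (Nat.card_fin r)
    have hqr : q ≤ rankTr ξ := by
      refine Nat.le_findGreatest (max_le (hbound s) (hbound t)) ?_
      rintro f g (rfl | ⟨hf, hg⟩)
      · exact ξ.refl f
      · exact ξ.trans (con_const_of_not_kerImEq hst hH f hf ⟨0, by omega⟩)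
          (ξ.symm (con_const_of_not_kerImEq hst hH g hg ⟨0, by omega⟩))
    -- `Nat.findGreatest` also returns `0` as a fallback, so its defining property is available only
    -- for a non-zero value; here the rank of `s` is positive.
    have hne : rankKappa ha θ ≠ 0 := by
      have := s.rank_pos
      have := le_max_left s.rank t.rank
      omega
    have hspec := Nat.findGreatest_of_ne_zero (m := rankKappa ha θ) rfl hne
    have hfull : ∀ u : Transf (Fin r), u.rank ≤ q → FullAt α ha θ u := by
      intro u hu
      have hu' : u.rank ≤ rankKappa ha θ := hu.trans (hqr.trans hle)
      refine ⟨top_unique fun k l _ => hspec _ _ ⟨(kappa_elt ha).2 rfl, Or.inr ⟨?_, ?_⟩⟩,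
        top_unique fun c d _ => hspec _ _ ⟨(kappa_elt ha).2 rfl, Or.inr ⟨?_, ?_⟩⟩⟩
      all_goals
        rw [Set.mem_ofPred_eq, rank_elt]
        exact hu'
    exact ⟨hfull s (le_max_left _ _), hfull t (le_max_right _ _)⟩
  · intro hle
    rcases eq_or_ne (rankTr ξ) 0 with h0 | h0
    · rw [h0]
      exact Nat.zero_le _
    have hspec := Nat.findGreatest_of_ne_zero (m := rankTr ξ) rfl h0
    have hqr : rankTr ξ ≤ a.rank := (Nat.findGreatest_le r).trans hrank.ge
    refine Nat.le_findGreatest hqr ?_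
    rintro f g ⟨hκ, rfl | ⟨hf, -⟩⟩
    · exact θ.refl f
    obtain ⟨k, s, c, rfl⟩ := exists_elt ha α f
    obtain ⟨l, t, d, rfl⟩ := exists_elt ha α g
    obtain rfl := (kappa_elt ha).1 hκ
    rw [Set.mem_ofPred_eq, rank_elt] at hf
    obtain ⟨z, hz⟩ := exists_const_not_kerImEq s
    have hsz : ξ s (Transf.const z) := hspec _ _ (Or.inr ⟨hf, by
      rw [Set.mem_ofPred_eq, Transf.rank_const]
      omega⟩)
    have hfull : FullAt α ha θ s := ((hle hsz).resolve_left hz).1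
    rw [con_elt_iff ha, hfull.1, hfull.2]
    exact ⟨(restrictTr ha α θ).refl s, trivial, trivial⟩

/-- If `u` is related to constants, retractions can be exchanged because an element with constant
projection does not depend on its retraction. For sections, the element with projection constant at
`y` sees only the value at `y`, and two different constants suffice to exchange any two sections. -/
theorem restrictTr_le_fullSetoid (ha : IsIdempotentElem a) (hr : 2 ≤ r) (σ : Con (Reg a)) :
    (restrictTr ha α σ).toSetoid ≤ fullSetoid α ha (σ ⊓ kappa ha) := by
  classical
  have : Nontrivial (Fin r) := Fin.nontrivial_iff_two_le.2 hr
  intro s t hst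
  by_cases hH : KerImEq s t
  · exact Or.inl hH
  right
  have hξ := con_const_of_not_kerImEq (ξ := restrictTr ha α σ) hst hH
  have hfull : ∀ u : Transf (Fin r), u.rank ≤ max s.rank t.rank →
      FullAt α ha (σ ⊓ kappa ha) u := by
    intro u hu
    rw [FullAt, lamAt_inf, rhoAt_inf, lamAt_kappa, rhoAt_kappa, inf_top_eq, inf_top_eq]
    obtain ⟨y, z, hyz⟩ := exists_pair_ne (Fin r)
    have huy := (restrictTr_apply ha σ _ _).1 (hξ u hu y)
    have huz := (restrictTr_apply ha σ _ _).1 (hξ u hu z)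
    have hleft : ∀ k : Ret α, σ (elt k u (sec ha α)) (elt k (Transf.const y) (sec ha α)) :=
      fun k => con_elt_left huy k (Transf.idn _)
    refine ⟨top_unique fun k l _ => ?_, top_unique fun c d _ => ?_⟩
    · have e : elt k (Transf.const y) (sec ha α) = elt l (Transf.const y) (sec ha α) :=
        elt_eq_iff.2 ⟨rfl, fun _ => rfl, fun _ => rfl⟩
      have h := hleft k
      rw [e] at h
      exact σ.trans h (σ.symm (hleft l))
    · have hy : ∀ c : Sec α, σ (elt (ret ha α) u c) (elt (ret ha α) (Transf.const y) c) :=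
        fun c => con_elt_right huy (Transf.idn _) c
      have hz : ∀ c : Sec α, σ (elt (ret ha α) u c) (elt (ret ha α) (Transf.const z) c) :=
        fun c => con_elt_right huz (Transf.idn _) c
      -- `b` agrees with `c` at `y` and with `d` at `z`, so the constant `y` links `c` to `b` and
      -- the constant `z` links `b` to `d`.
      let b : Sec α := ⟨Function.update d.1 y (c.1 y), fun i => by
        rcases eq_or_ne i y with rfl | hi
        · rw [Function.update_self, c.2]
        · rw [Function.update_of_ne hi, d.2]⟩
      have e1 : elt (ret ha α) (Transf.const y) c = elt (ret ha α) (Transf.const y) b :=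
        elt_eq_iff.2 ⟨rfl, fun _ => rfl, fun _ => (Function.update_self y (c.1 y) d.1).symm⟩
      have e2 : elt (ret ha α) (Transf.const z) b = elt (ret ha α) (Transf.const z) d :=
        elt_eq_iff.2 ⟨rfl, fun _ => rfl, fun _ => Function.update_of_ne hyz.symm _ _⟩
      have h1 := hy c
      rw [e1] at h1
      have h2 := hz b
      rw [e2] at h2
      exact σ.trans h1 (σ.trans (σ.symm (hy b)) (σ.trans h2 (σ.symm (hz d))))
  exact ⟨hfull s (le_max_left _ _), hfull t (le_max_right _ _)⟩

theorem congMap_injective (ha : IsIdempotentElem a) (α : Fin r ≃ a.im) :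
    Function.Injective (congMap ha α) := by
  intro σ τ h
  have h1 : restrictTr ha α σ = restrictTr ha α τ := congrArg Prod.fst h
  have h2 : σ ⊓ kappa ha = τ ⊓ kappa ha := congrArg Subtype.val (congrArg Prod.snd h)
  refine con_ext_elt ha α fun k l s t c d => ?_
  have hl : ∀ σ : Con (Reg a), LamAt ha α σ s = LamAt ha α (σ ⊓ kappa ha) s := fun σ => by
    rw [lamAt_inf, lamAt_kappa, inf_top_eq]
  have hr : ∀ σ : Con (Reg a), RhoAt ha α σ s = RhoAt ha α (σ ⊓ kappa ha) s := fun σ => by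
    rw [rhoAt_inf, rhoAt_kappa, inf_top_eq]
  rw [con_elt_iff ha, con_elt_iff ha, h1, hl σ, hl τ, hr σ, hr τ, h2]

/-- Inclusion in `fullSetoid` is just what makes the kernel and image relations of `θ` constant
along `ξ`, so the pair glues to a congruence. -/
theorem range_congMap (ha : IsIdempotentElem a) (hr : 2 ≤ r) (α : Fin r ≃ a.im) :
    Set.range (congMap ha α) = {p | p.1.toSetoid ≤ fullSetoid α ha p.2.1} := by
  ext ⟨ξ, θ, hbot, hθ⟩
  constructor
  · rintro ⟨σ, h⟩
    rw [← h]
    exact restrictTr_le_fullSetoid ha hr σ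
  · intro h
    replace h : ξ.toSetoid ≤ fullSetoid α ha θ := h
    let D : ConData α := ⟨ξ, LamAt ha α θ, RhoAt ha α θ, fun _ _ _ => lamAt_of_forall_eq ha θ,
      fun _ _ _ => rhoAt_of_forall_eq ha θ, LamAt.le_mul ha θ, RhoAt.le_mul ha θ,
      fun _ _ e => lamAt_eq_of_fullSetoid (h e), fun _ _ e => rhoAt_eq_of_fullSetoid (h e)⟩
    refine ⟨D.toCon ha, Prod.ext (Con.ext fun s t => ?_) (Subtype.ext ?_)⟩
    · refine (restrictTr_apply ha (D.toCon ha) s t).trans ((D.toCon_elt ha).trans ?_)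
      exact ⟨fun e => e.1, fun e => ⟨e, (D.ker s).refl' _, (D.img s).refl' _⟩⟩
    · refine con_ext_of_le_kappa (α := α) ha inf_le_right hθ (fun s => ?_) fun s => ?_
      · change LamAt ha α (D.toCon ha ⊓ kappa ha) s = LamAt ha α θ s
        rw [lamAt_inf, lamAt_kappa, inf_top_eq, D.lamAt_toCon]
      · change RhoAt ha α (D.toCon ha ⊓ kappa ha) s = RhoAt ha α θ s
        rw [rhoAt_inf, rhoAt_kappa, inf_top_eq, D.rhoAt_toCon]

theorem congMap_isSubdirectEmbedding₂ (ha : IsIdempotentElem a) (hr : 2 ≤ r)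
    (α : Fin r ≃ a.im) : IsSubdirectEmbedding₂ (congMap ha α) := by
  have hrange := range_congMap ha hr α
  refine ⟨.of_inf (congMap_injective ha α) (fun σ τ => ?_) fun σ τ => ?_,
    congMap_injective ha α, fun ξ => ?_, fun θ => ?_⟩
  · exact Prod.ext rfl (Subtype.ext (inf_inf_distrib_right ..))
  · have h1 : congMap ha α σ ∈ Set.range (congMap ha α) := ⟨σ, rfl⟩
    have h2 : congMap ha α τ ∈ Set.range (congMap ha α) := ⟨τ, rfl⟩
    rw [hrange] at h1 h2 ⊢
    exact con_sup_le_setoid (h1.trans (fullSetoid_mono le_sup_left))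
      (h2.trans (fullSetoid_mono le_sup_right))
  · have h : (ξ, (⟨kappa ha, bot_le, le_rfl⟩ : Set.Icc (⊥ : Con (Reg a)) (kappa ha))) ∈
        Set.range (congMap ha α) := by
      rw [hrange]
      exact fun s t _ => Or.inr
        ⟨⟨lamAt_kappa ha s, rhoAt_kappa ha s⟩, ⟨lamAt_kappa ha t, rhoAt_kappa ha t⟩⟩
    obtain ⟨σ, hσ⟩ := h
    exact ⟨σ, congrArg Prod.fst hσ⟩
  · have h : ((⊥ : Con (Transf (Fin r))), θ) ∈ Set.range (congMap ha α) := by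
      rw [hrange]
      intro s t hst
      obtain rfl : s = t := hst
      exact Or.inl ⟨fun _ _ => Iff.rfl, rfl⟩
    obtain ⟨σ, hσ⟩ := h
    exact ⟨σ, congrArg Prod.snd hσ⟩

end

/-! ### Subdirect embeddings into products of equivalence lattices -/

/-- An injective meet-preserving map onto the families of equivalences that are compatible with
a system of restriction maps is a subdirect embedding. -/
theorem IsSubdirectEmbedding.of_range {ι L : Type*} [Lattice L] {Z : ι → Type*}
    (le : ι → ι → Prop) (htrans : ∀ i j k, le i j → le j k → le i k)
    (hanti : ∀ i j, le i j → le j i → i = j) (res : ∀ i j, le j i → Z i → Z j)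
    (hres : ∀ i h z, res i i h z = z) {Ψ : L → ∀ i, Setoid (Z i)}
    (hinj : Function.Injective Ψ) (hinf : ∀ x y, Ψ (x ⊓ y) = Ψ x ⊓ Ψ y)
    (hrange : Set.range Ψ = {ψ | ∀ i j (h : le j i), ψ i ≤ (ψ j).comap (res i j h)}) :
    IsSubdirectEmbedding Ψ := by
  classical
  refine ⟨.of_inf hinj hinf fun x y => ?_, hinj, fun i ψ₀ => ?_⟩
  · have hx : Ψ x ∈ Set.range Ψ := ⟨x, rfl⟩
    have hy : Ψ y ∈ Set.range Ψ := ⟨y, rfl⟩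
    rw [hrange] at hx hy ⊢
    exact fun i j h => sup_le
      ((hx i j h).trans fun _ _ e => (le_sup_left : Ψ x j ≤ Ψ x j ⊔ Ψ y j) e)
      ((hy i j h).trans fun _ _ e => (le_sup_right : Ψ y j ≤ Ψ x j ⊔ Ψ y j) e)
  · let ψ : ∀ j, Setoid (Z j) :=
      Function.update (fun j => if le j i then ⊤ else ⊥) i ψ₀
    have hψi : ψ i = ψ₀ := Function.update_self ..
    have hψ : ∀ j, j ≠ i → ψ j = if le j i then ⊤ else ⊥ := fun j hj =>
      Function.update_of_ne hj ..
    have hmem : ψ ∈ Set.range Ψ := by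
      rw [hrange]
      intro m j h z z' hz
      change ψ j _ _
      by_cases hmi : m = i
      · subst hmi
        by_cases hj : j = m
        · subst hj
          rwa [hres, hres]
        · rw [hψ j hj, if_pos h]
          trivial
      · rw [hψ m hmi] at hz
        by_cases hle : le m i
        · have hj : j ≠ i := by
            rintro rfl
            exact hmi (hanti _ _ hle h)
          rw [hψ j hj, if_pos (htrans _ _ _ h hle)]
          trivial
        · rw [if_neg hle] at hz
          obtain rfl : z = z' := hz
          exact (ψ j).refl' _
    obtain ⟨x, hx⟩ := hmem
    exact ⟨x, by rw [← hψi, ← hx]⟩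

section

variable {X : Type*} {a : Transf X} {r : ℕ} {α : Fin r ≃ a.im}

/-! ### Congruences below `ρ` and cross-sections -/

/-- The cross-section `{c_i : i ∈ I}`. -/
def cross (c : Sec α) (I : NESubset r) : CrossSections α I :=
  ⟨c.1 '' I.1, c.1, fun i _ => c.2 i, rfl⟩

theorem exists_cross (ha : IsIdempotentElem a) {I : NESubset r} (C : CrossSections α I) :
    ∃ c : Sec α, C = cross c I := by
  classical
  obtain ⟨_, c, hc, rfl⟩ := C
  refine ⟨⟨fun i => if i ∈ I.1 then c i else (α i).1, fun i => ?_⟩, Subtype.ext ?_⟩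
  · dsimp only
    split_ifs with h
    · exact hc i h
    · exact apply_enum ha α i
  · exact Set.image_congr fun i hi => (if_pos hi).symm

theorem cross_restrict (c : Sec α) {I J : NESubset r} (h : J.1 ⊆ I.1) :
    (cross c I).restrict α h = cross c J :=
  Subtype.ext (crossRestrict_image α h c.1 fun i _ => c.2 i)

theorem image_sec_eq_iff {c d : Sec α} {I J : Set (Fin r)} :
    c.1 '' I = d.1 '' J ↔ I = J ∧ ∀ i ∈ I, c.1 i = d.1 i := by
  constructor
  · intro h
    have hsub : ∀ {c d : Sec α} {I J : Set (Fin r)}, c.1 '' I = d.1 '' J →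
        ∀ i ∈ I, i ∈ J ∧ c.1 i = d.1 i := by
      intro c d I J h i hi
      obtain ⟨j, hj, e⟩ := h.subset ⟨i, hi, rfl⟩
      obtain rfl := Sec.inj d c e
      exact ⟨hj, e.symm⟩
    exact ⟨Set.Subset.antisymm (fun i hi => (hsub h i hi).1) fun i hi => (hsub h.symm i hi).1,
      fun i hi => (hsub h i hi).2⟩
  · rintro ⟨rfl, h⟩
    exact Set.image_congr h

theorem im_elt_eq_cross {k : Ret α} {s : Transf (Fin r)} {c d : Sec α} {I : NESubset r} :
    (elt k s c).1.toTransf.im = (cross d I).1 ↔ s.im = I.1 ∧ ∀ i, c.1 (s i) = d.1 (s i) := by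
  rw [im_elt]
  exact image_sec_eq_iff.trans (and_congr_right fun _ => Set.forall_mem_range)

theorem Transf.exists_im_eq {Y : Type*} {I : Set Y} (hI : I.Nonempty) :
    ∃ s : Transf Y, s.im = I := by
  classical
  obtain ⟨y, hy⟩ := hI
  refine ⟨fun i => if i ∈ I then i else y, Set.Subset.antisymm ?_ fun i hi => ⟨i, if_pos hi⟩⟩
  rintro _ ⟨i, rfl⟩
  dsimp only
  split_ifs with h
  · exact h
  · exact hy

/-- The image of an element determines the image of its projection and the section on it. As `RhoAt`
depends only on the image of the projection, any `s` with image `I` may be used. -/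
theorem exists_im_eq_cross_iff (ha : IsIdempotentElem a) {θ : Con (Reg a)} (hθ : θ ≤ kappa ha)
    {I : NESubset r} {s : Transf (Fin r)} (hs : s.im = I.1) {c d : Sec α} :
    (∃ f g : Reg a, θ f g ∧ f.1.toTransf.im = (cross c I).1 ∧ g.1.toTransf.im = (cross d I).1) ↔
      RhoAt ha α θ s c d := by
  constructor
  · rintro ⟨f, g, hfg, hf, hg⟩
    obtain ⟨k, t, c', rfl⟩ := exists_elt ha α f
    obtain ⟨l, u, d', rfl⟩ := exists_elt ha α g
    obtain ⟨rfl, -, h⟩ := (con_elt_iff_of_le_kappa ha hθ).1 hfg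
    rw [im_elt_eq_cross] at hf hg
    have h' := (RhoAt ha α θ t).trans' ((RhoAt ha α θ t).symm' (rhoAt_of_forall_eq ha θ hf.2))
      ((RhoAt ha α θ t).trans' h (rhoAt_of_forall_eq ha θ hg.2))
    exact RhoAt.mono (hs.trans hf.1.symm).le h'
  · intro h
    exact ⟨_, _, h, im_elt_eq_cross.2 ⟨hs, fun _ => rfl⟩, im_elt_eq_cross.2 ⟨hs, fun _ => rfl⟩⟩

variable (α) in
/-- The equivalences `Ψ_I(θ)` on cross-sections. -/
def crossFamily (ha : IsIdempotentElem a) (θ : Set.Icc (⊥ : Con (Reg a)) (rho ha))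
    (I : NESubset r) : Setoid (CrossSections α I) where
  r C C' := ∃ f g : Reg a, θ.1 f g ∧ f.1.toTransf.im = C.1 ∧ g.1.toTransf.im = C'.1
  iseqv := by
    have hθ : θ.1 ≤ kappa ha := θ.2.2.trans (rho_le_kappa ha)
    obtain ⟨s, hs⟩ := Transf.exists_im_eq I.2
    refine ⟨fun C => ?_, fun {C D} => ?_, fun {C D E} => ?_⟩
    · obtain ⟨c, rfl⟩ := exists_cross ha C
      exact (exists_im_eq_cross_iff ha hθ hs).2 ((RhoAt ha α θ.1 s).refl' c)
    · rintro ⟨f, g, h, hf, hg⟩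
      exact ⟨g, f, θ.1.symm h, hg, hf⟩
    · obtain ⟨c, rfl⟩ := exists_cross ha C
      obtain ⟨d, rfl⟩ := exists_cross ha D
      obtain ⟨e, rfl⟩ := exists_cross ha E
      rw [exists_im_eq_cross_iff ha hθ hs, exists_im_eq_cross_iff ha hθ hs,
        exists_im_eq_cross_iff ha hθ hs]
      exact (RhoAt ha α θ.1 s).trans'

theorem crossFamily_cross (ha : IsIdempotentElem a) (θ : Set.Icc (⊥ : Con (Reg a)) (rho ha))
    {I : NESubset r} {s : Transf (Fin r)} (hs : s.im = I.1) {c d : Sec α} :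
    crossFamily α ha θ I (cross c I) (cross d I) ↔ RhoAt ha α θ.1 s c d :=
  exists_im_eq_cross_iff ha (θ.2.2.trans (rho_le_kappa ha)) hs

theorem crossFamily_injective (ha : IsIdempotentElem a) (hr : 2 ≤ r) (α : Fin r ≃ a.im) :
    Function.Injective (crossFamily α ha) := by
  have : Nonempty (Fin r) := ⟨⟨0, by omega⟩⟩
  intro θ η h
  refine Subtype.ext (con_ext_of_le_rho (α := α) ha θ.2.2 η.2.2 fun s => Setoid.ext fun c d => ?_)
  rw [← crossFamily_cross ha θ (I := ⟨s.im, Set.range_nonempty _⟩) rfl, h,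
    crossFamily_cross ha η rfl]

theorem crossFamily_inf (ha : IsIdempotentElem a) (θ η : Set.Icc (⊥ : Con (Reg a)) (rho ha)) :
    crossFamily α ha (θ ⊓ η) = crossFamily α ha θ ⊓ crossFamily α ha η := by
  funext I
  refine Setoid.ext fun C D => ?_
  obtain ⟨s, hs⟩ := Transf.exists_im_eq I.2
  obtain ⟨c, rfl⟩ := exists_cross ha C
  obtain ⟨d, rfl⟩ := exists_cross ha D
  exact (crossFamily_cross ha _ hs).trans
    (and_congr (crossFamily_cross ha _ hs) (crossFamily_cross ha _ hs)).symm

theorem crossClosed_iff {ψ : ∀ I : NESubset r, Setoid (CrossSections α I)} :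
    CrossClosed α ψ ↔ ∀ (I J : NESubset r) (h : J.1 ⊆ I.1),
      ψ I ≤ (ψ J).comap (CrossSections.restrict α h) := by
  constructor
  · exact fun H I J h C C' hC => H I J h _ _ ⟨C, C', hC, rfl, rfl⟩
  · rintro H I J h _ _ ⟨C, C', hC, rfl, rfl⟩
    exact H I J h hC

theorem range_crossFamily (ha : IsIdempotentElem a) (hr : 2 ≤ r) (α : Fin r ≃ a.im) :
    Set.range (crossFamily α ha) = {ψ | CrossClosed α ψ} := by
  have : Nonempty (Fin r) := ⟨⟨0, by omega⟩⟩
  ext ψ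
  rw [Set.mem_ofPred_eq, crossClosed_iff]
  constructor
  · rintro ⟨θ, rfl⟩ I J h C C' hC
    obtain ⟨c, rfl⟩ := exists_cross ha C
    obtain ⟨d, rfl⟩ := exists_cross ha C'
    obtain ⟨s, hs⟩ := Transf.exists_im_eq I.2
    obtain ⟨t, ht⟩ := Transf.exists_im_eq J.2
    change crossFamily α ha θ J _ _
    rw [cross_restrict, cross_restrict, crossFamily_cross ha θ ht]
    refine RhoAt.mono ?_ ((crossFamily_cross ha θ hs).1 hC)
    rw [hs, ht]
    exact h
  · intro H
    let im (s : Transf (Fin r)) : NESubset r := ⟨s.im, Set.range_nonempty _⟩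
    have hcongr : ∀ s (c d : Sec α), (∀ i, c.1 (s i) = d.1 (s i)) →
        cross c (im s) = cross d (im s) := fun s c d h =>
      Subtype.ext (image_sec_eq_iff.2 ⟨rfl, Set.forall_mem_range.2 h⟩)
    -- Taking the kernel relations of `ρ`, the least ones allowed, keeps `θ` below `ρ`.
    obtain ⟨θ, hθ, hl, hrho⟩ := exists_con_le_kappa ha (LamAt ha α (rho ha))
      (fun s => (ψ (im s)).comap fun c => cross c (im s))
      (fun _ _ _ => lamAt_of_forall_eq ha _)
      (fun s c d h => by
        change ψ (im s) (cross c (im s)) (cross d (im s))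
        rw [hcongr s c d h])
      (LamAt.le_mul ha _)
      (fun u s c d h => by
        have hsub : (im (u * s)).1 ⊆ (im s).1 := by
          rintro _ ⟨i, rfl⟩
          exact ⟨u i, rfl⟩
        have h' := H _ _ hsub h
        change ψ _ _ _ at h'
        rwa [cross_restrict, cross_restrict] at h')
    have hθρ : θ ≤ rho ha := by
      intro f g
      obtain ⟨k, s, c, rfl⟩ := exists_elt ha α f
      obtain ⟨l, t, d, rfl⟩ := exists_elt ha α g
      rw [con_elt_iff_of_le_kappa ha hθ, hl, rho_elt]
      rintro ⟨rfl, h, -⟩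
      exact ⟨rfl, ((rho_elt ha).1 h).2⟩
    refine ⟨⟨θ, bot_le, hθρ⟩, funext fun I => Setoid.ext fun C D => ?_⟩
    obtain ⟨s, hs⟩ := Transf.exists_im_eq I.2
    obtain rfl : im s = I := Subtype.ext hs
    obtain ⟨c, rfl⟩ := exists_cross ha C
    obtain ⟨d, rfl⟩ := exists_cross ha D
    rw [crossFamily_cross ha _ hs, hrho]
    rfl

theorem crossFamily_isSubdirectEmbedding (ha : IsIdempotentElem a) (hr : 2 ≤ r)
    (α : Fin r ≃ a.im) : IsSubdirectEmbedding (crossFamily α ha) := by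
  refine .of_range (fun J I : NESubset r => J.1 ⊆ I.1)
    (fun _ _ _ => Set.Subset.trans) (fun _ _ h h' => Subtype.ext (Set.Subset.antisymm h h'))
    (fun _ _ h => CrossSections.restrict α h) (fun I h C => ?_) (crossFamily_injective ha hr α)
    (crossFamily_inf ha) ?_
  · obtain ⟨c, rfl⟩ := exists_cross ha C
    exact cross_restrict c h
  · rw [range_crossFamily ha hr]
    exact Set.ext fun _ => crossClosed_iff

/-! ### Congruences below `λ` and partitions -/

/-- The partition of `[r]` into the kernel classes of a transformation. -/
def kerPart (s : Transf (Fin r)) : Part r :=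
  ⟨(Setoid.ker fun i => s i).classes, Setoid.isPartition_classes _⟩

/-- Each point is sent to a chosen representative of its block. -/
theorem exists_kerPart_eq (I : Part r) : ∃ s : Transf (Fin r), kerPart s = I := by
  let e : Setoid (Fin r) := Setoid.mkClasses I.1 I.2.2
  refine ⟨fun i => (Quotient.mk e i).out, Subtype.ext ?_⟩
  have h : (Setoid.ker fun i => (Quotient.mk e i).out) = e := Setoid.ext fun i j => by
    rw [Setoid.ker_def, Quotient.out_inj, Quotient.eq]
  change (Setoid.ker fun i => (Quotient.mk e i).out).classes = I.1
  rw [h]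
  exact Setoid.classes_mkClasses I.1 I.2

theorem coarser_kerPart_iff {s t : Transf (Fin r)} :
    Coarser (kerPart t) (kerPart s) ↔ ∀ i j, s i = s j → t i = t j := by
  constructor
  · intro h i j e
    obtain ⟨_, ⟨m, rfl⟩, hsub⟩ := h _ ⟨j, rfl⟩
    have hi : t i = t m := hsub (show s i = s j from e)
    have hj : t j = t m := hsub (show s j = s j from rfl)
    rw [hi, hj]
  · rintro h _ ⟨j, rfl⟩
    exact ⟨_, ⟨j, rfl⟩, fun i hi => h i j hi⟩

theorem Coarser.trans {I J K : Part r} (h : Coarser I J) (h' : Coarser J K) : Coarser I K := by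
  intro B hB
  obtain ⟨C, hC, hBC⟩ := h' B hB
  obtain ⟨D, hD, hCD⟩ := h C hC
  exact ⟨D, hD, hBC.trans hCD⟩

theorem kerPart_eq_iff {s t : Transf (Fin r)} :
    kerPart s = kerPart t ↔ ∀ i j, s i = s j ↔ t i = t j := by
  rw [kerPart, kerPart, Subtype.mk.injEq, ← Setoid.classes_inj, Setoid.ext_iff]
  rfl

theorem Coarser.antisymm {I J : Part r} (h : Coarser I J) (h' : Coarser J I) : I = J := by
  obtain ⟨s, rfl⟩ := exists_kerPart_eq I
  obtain ⟨t, rfl⟩ := exists_kerPart_eq J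
  rw [coarser_kerPart_iff] at h h'
  exact kerPart_eq_iff.2 fun i j => ⟨h' i j, h i j⟩

theorem preimage_ret_inter (k : Ret α) (B : Set (Fin r)) :
    k.1 ⁻¹' B ∩ a.im = imSet α B := by
  ext x
  constructor
  · rintro ⟨hx, hxa⟩
    refine ⟨α.symm ⟨x, hxa⟩, ?_, by simp only [Equiv.apply_symm_apply]⟩
    have := k.2 (α.symm ⟨x, hxa⟩)
    rw [Equiv.apply_symm_apply] at this
    rw [← this]
    exact hx
  · rintro ⟨i, hi, rfl⟩
    exact ⟨by rwa [Set.mem_preimage, k.2], (α i).2⟩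

/-- The partition of `X` whose blocks are the preimages of the blocks of `I`. -/
def part (k : Ret α) (I : Part r) : PartitionsOver α I :=
  ⟨(fun B => k.1 ⁻¹' B) '' I.1, by
    refine ⟨⟨?_, fun x => ?_⟩, fun B => k.1 ⁻¹' B, fun B _ => preimage_ret_inter k B, rfl⟩
    · rintro ⟨B, hB, h⟩
      obtain ⟨i, hi⟩ := Setoid.nonempty_of_mem_partition I.2 hB
      have : (α i).1 ∈ k.1 ⁻¹' B := by rwa [Set.mem_preimage, k.2]
      dsimp only at h
      rw [h] at this
      exact this
    · obtain ⟨B, ⟨hB, hx⟩, huniq⟩ := I.2.2 (k.1 x)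
      refine ⟨_, ⟨⟨B, hB, rfl⟩, hx⟩, ?_⟩
      rintro _ ⟨⟨C, hC, rfl⟩, hxC⟩
      dsimp only
      rw [huniq C ⟨hC, hxC⟩]⟩

theorem imSet_injective (α : Fin r ≃ a.im) : Function.Injective (imSet α) := fun _ _ h =>
  Set.Subset.antisymm ((imSet_subset_iff α).1 h.le) ((imSet_subset_iff α).1 h.ge)

/-- Each point `x` of a block `p B` is sent to an index in `B`: its own index if `x` lies in
`im(a)`, an arbitrary one otherwise. -/
theorem exists_part {I : Part r} (Q : PartitionsOver α I) : ∃ k : Ret α, Q = part k I := by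
  obtain ⟨_, hpart, p, hp, rfl⟩ := Q
  have hex : ∀ x, ∃ i, (x ∈ a.im → (α i).1 = x) ∧ ∃ B ∈ I.1, x ∈ p B ∧ i ∈ B := by
    intro x
    obtain ⟨_, ⟨⟨B, hB, rfl⟩, hx⟩, -⟩ := hpart.2 x
    by_cases hxa : x ∈ a.im
    · obtain ⟨i, hi, e⟩ := (hp B hB).subset ⟨hx, hxa⟩
      exact ⟨i, fun _ => e, B, hB, hx, hi⟩
    · obtain ⟨i, hi⟩ := Setoid.nonempty_of_mem_partition I.2 hB
      exact ⟨i, fun h => absurd h hxa, B, hB, hx, hi⟩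
  choose k hk hkB using hex
  refine ⟨⟨k, fun i => α.injective (Subtype.ext (hk _ (α i).2))⟩,
    Subtype.ext (Set.image_congr fun B hB => Set.ext fun x => ?_)⟩
  obtain ⟨C, hC, hxC, hkC⟩ := hkB x
  constructor
  · intro hx
    have e : p B = p C := (hpart.2 x).unique ⟨⟨B, hB, rfl⟩, hx⟩ ⟨⟨C, hC, rfl⟩, hxC⟩
    have e' : B = C := imSet_injective α (by rw [← hp B hB, ← hp C hC, e])
    exact e' ▸ hkC
  · intro hx
    have e : B = C := (I.2.2 (k x)).unique ⟨hB, hx⟩ ⟨hC, hkC⟩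
    exact e ▸ hxC

theorem part_restrict (k : Ret α) {I J : Part r} (h : Coarser J I) :
    (part k I).restrict α h = part k J := by
  refine Subtype.ext (Set.image_congr fun C hC => ?_)
  change unionOver α ((fun B => k.1 ⁻¹' B) '' I.1) C = k.1 ⁻¹' C
  rw [unionOver_image α _ fun B _ => preimage_ret_inter k B]
  ext x
  constructor
  · rintro ⟨_, ⟨B, ⟨-, hBC⟩, rfl⟩, hx⟩
    exact hBC hx
  · intro hx
    obtain ⟨B, ⟨hB, hxB⟩, -⟩ := I.2.2 (k.1 x)
    obtain ⟨D, hD, hBD⟩ := h B hB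
    obtain rfl : D = C := (J.2.2 (k.1 x)).unique ⟨hD, hBD hxB⟩ ⟨hC, hx⟩
    exact ⟨_, ⟨B, ⟨hB, hBD⟩, rfl⟩, hxB⟩

theorem kerClasses_elt (k : Ret α) (s : Transf (Fin r)) (c : Sec α) :
    (elt k s c).1.toTransf.kerClasses = (part k (kerPart s)).1 := by
  have hset : ∀ i, {y | c.1 (s (k.1 y)) = c.1 (s i)} = k.1 ⁻¹' {j | s j = s i} := fun i =>
    Set.ext fun y => ⟨fun e => Sec.inj c c e, fun e => congrArg c.1 e⟩
  ext Q
  constructor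
  · rintro ⟨x, rfl⟩
    exact ⟨_, ⟨k.1 x, rfl⟩, (hset (k.1 x)).symm⟩
  · rintro ⟨_, ⟨i, rfl⟩, rfl⟩
    refine ⟨(α i).1, ?_⟩
    change k.1 ⁻¹' {j | s j = s i} = {y | c.1 (s (k.1 y)) = c.1 (s (k.1 (α i).1))}
    rw [k.2, hset]

/-- Intersecting a block with `im(a)` recovers the set of indices it lies over, so equal partitions
have equal blocks over equal index sets. -/
theorem part_val_eq_iff {k l : Ret α} {I : Part r} {s : Transf (Fin r)} :
    (part k (kerPart s)).1 = (part l I).1 ↔ kerPart s = I ∧ ∀ x, s (k.1 x) = s (l.1 x) := by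
  constructor
  · intro h
    have hmem : ∀ {k l : Ret α} {I J : Part r}, (part k I).1 = (part l J).1 →
        ∀ B ∈ I.1, B ∈ J.1 ∧ k.1 ⁻¹' B = l.1 ⁻¹' B := by
      intro k l I J h B hB
      obtain ⟨C, hC, e⟩ := h.subset ⟨B, hB, rfl⟩
      have e' : l.1 ⁻¹' C = k.1 ⁻¹' B := e
      obtain rfl : C = B := imSet_injective α (by
        rw [← preimage_ret_inter l, ← preimage_ret_inter k, e'])
      exact ⟨hC, e'.symm⟩
    refine ⟨Subtype.ext (Set.Subset.antisymm (fun B hB => (hmem h B hB).1)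
      fun B hB => (hmem h.symm B hB).1), fun x => ?_⟩
    have e := (hmem h _ ⟨k.1 x, rfl⟩).2
    exact (e.subset (show s (k.1 x) = s (k.1 x) from rfl) : s (l.1 x) = s (k.1 x)).symm
  · rintro ⟨rfl, h⟩
    refine Set.image_congr ?_
    rintro _ ⟨i, rfl⟩
    ext x
    change s (k.1 x) = s i ↔ s (l.1 x) = s i
    rw [h]

theorem kerClasses_elt_eq_part {k l : Ret α} {s : Transf (Fin r)} {c : Sec α} {I : Part r} :
    (elt k s c).1.toTransf.kerClasses = (part l I).1 ↔
      kerPart s = I ∧ ∀ x, s (k.1 x) = s (l.1 x) := by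
  rw [kerClasses_elt, part_val_eq_iff]

theorem exists_kerClasses_eq_part_iff (ha : IsIdempotentElem a) {θ : Con (Reg a)}
    (hθ : θ ≤ kappa ha) {s : Transf (Fin r)} {k l : Ret α} :
    (∃ f g : Reg a, θ f g ∧ f.1.toTransf.kerClasses = (part k (kerPart s)).1 ∧
      g.1.toTransf.kerClasses = (part l (kerPart s)).1) ↔ LamAt ha α θ s k l := by
  constructor
  · rintro ⟨f, g, hfg, hf, hg⟩
    obtain ⟨k', t, c, rfl⟩ := exists_elt ha α f
    obtain ⟨l', u, d, rfl⟩ := exists_elt ha α g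
    obtain ⟨rfl, h, -⟩ := (con_elt_iff_of_le_kappa ha hθ).1 hfg
    rw [kerClasses_elt_eq_part] at hf hg
    have h' := (LamAt ha α θ t).trans' ((LamAt ha α θ t).symm' (lamAt_of_forall_eq ha θ hf.2))
      ((LamAt ha α θ t).trans' h (lamAt_of_forall_eq ha θ hg.2))
    exact LamAt.mono (fun i j => (kerPart_eq_iff.1 hf.1 i j).1) h'
  · intro h
    exact ⟨_, _, h, kerClasses_elt _ _ _, kerClasses_elt _ _ _⟩

variable (α) in
/-- The equivalences `Ψ_I(θ)` on partitions. -/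
def partFamily (ha : IsIdempotentElem a) (θ : Set.Icc (⊥ : Con (Reg a)) (lam ha))
    (I : Part r) : Setoid (PartitionsOver α I) where
  r Q Q' := ∃ f g : Reg a,
    θ.1 f g ∧ f.1.toTransf.kerClasses = Q.1 ∧ g.1.toTransf.kerClasses = Q'.1
  iseqv := by
    have hθ : θ.1 ≤ kappa ha := θ.2.2.trans (lam_le_kappa ha)
    obtain ⟨s, rfl⟩ := exists_kerPart_eq I
    refine ⟨fun P => ?_, fun {P Q} => ?_, fun {P Q R} => ?_⟩
    · obtain ⟨k, rfl⟩ := exists_part P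
      exact (exists_kerClasses_eq_part_iff ha hθ).2 ((LamAt ha α θ.1 s).refl' k)
    · rintro ⟨f, g, h, hf, hg⟩
      exact ⟨g, f, θ.1.symm h, hg, hf⟩
    · obtain ⟨k, rfl⟩ := exists_part P
      obtain ⟨l, rfl⟩ := exists_part Q
      obtain ⟨m, rfl⟩ := exists_part R
      rw [exists_kerClasses_eq_part_iff ha hθ, exists_kerClasses_eq_part_iff ha hθ,
        exists_kerClasses_eq_part_iff ha hθ]
      exact (LamAt ha α θ.1 s).trans'

theorem partFamily_part (ha : IsIdempotentElem a) (θ : Set.Icc (⊥ : Con (Reg a)) (lam ha))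
    {s : Transf (Fin r)} {k l : Ret α} :
    partFamily α ha θ (kerPart s) (part k _) (part l _) ↔ LamAt ha α θ.1 s k l :=
  exists_kerClasses_eq_part_iff ha (θ.2.2.trans (lam_le_kappa ha))

theorem partFamily_injective (ha : IsIdempotentElem a) (α : Fin r ≃ a.im) :
    Function.Injective (partFamily α ha) := by
  intro θ η h
  refine Subtype.ext (con_ext_of_le_lam (α := α) ha θ.2.2 η.2.2 fun s => Setoid.ext fun k l => ?_)
  rw [← partFamily_part ha θ, h, partFamily_part ha η]

theorem partFamily_inf (ha : IsIdempotentElem a) (θ η : Set.Icc (⊥ : Con (Reg a)) (lam ha)) :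
    partFamily α ha (θ ⊓ η) = partFamily α ha θ ⊓ partFamily α ha η := by
  funext I
  refine Setoid.ext fun P Q => ?_
  obtain ⟨s, rfl⟩ := exists_kerPart_eq I
  obtain ⟨k, rfl⟩ := exists_part P
  obtain ⟨l, rfl⟩ := exists_part Q
  exact (partFamily_part ha _).trans
    (and_congr (partFamily_part ha _) (partFamily_part ha _)).symm

theorem partClosed_iff {ψ : ∀ I : Part r, Setoid (PartitionsOver α I)} :
    PartClosed α ψ ↔ ∀ (I J : Part r) (h : Coarser J I),
      ψ I ≤ (ψ J).comap (PartitionsOver.restrict α h) := by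
  constructor
  · exact fun H I J h P Q hP => H I J h _ _ ⟨P, Q, hP, rfl, rfl⟩
  · rintro H I J h _ _ ⟨P, Q, hP, rfl, rfl⟩
    exact H I J h hP

theorem range_partFamily (ha : IsIdempotentElem a) (α : Fin r ≃ a.im) :
    Set.range (partFamily α ha) = {ψ | PartClosed α ψ} := by
  ext ψ
  rw [Set.mem_ofPred_eq, partClosed_iff]
  constructor
  · rintro ⟨θ, rfl⟩ I J h P Q hP
    obtain ⟨s, rfl⟩ := exists_kerPart_eq I
    obtain ⟨t, rfl⟩ := exists_kerPart_eq J
    obtain ⟨k, rfl⟩ := exists_part P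
    obtain ⟨l, rfl⟩ := exists_part Q
    change partFamily α ha θ (kerPart t) _ _
    rw [part_restrict, part_restrict, partFamily_part ha θ]
    exact LamAt.mono (coarser_kerPart_iff.1 h) ((partFamily_part ha θ).1 hP)
  · intro H
    -- Dually to the case of `ρ`, the image relations are those of `λ`, the least ones allowed.
    obtain ⟨θ, hθ, hlam, hrho⟩ := exists_con_le_kappa ha
      (fun s => (ψ (kerPart s)).comap fun k => part k (kerPart s)) (RhoAt ha α (lam ha))
      (fun s k l h => by
        change ψ _ (part k (kerPart s)) (part l (kerPart s))
        rw [show part k (kerPart s) = part l (kerPart s) from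
          Subtype.ext (part_val_eq_iff.2 ⟨rfl, h⟩)])
      (fun _ _ _ => rhoAt_of_forall_eq ha _)
      (fun s u k l h => by
        have hco : Coarser (kerPart (s * u)) (kerPart s) :=
          coarser_kerPart_iff.2 fun i j e => congrArg u e
        have h' := H _ _ hco h
        change ψ _ _ _ at h'
        rwa [part_restrict, part_restrict] at h')
      (RhoAt.le_mul ha _)
    have hθl : θ ≤ lam ha := by
      intro f g
      obtain ⟨k, s, c, rfl⟩ := exists_elt ha α f
      obtain ⟨l, t, d, rfl⟩ := exists_elt ha α g
      rw [con_elt_iff_of_le_kappa ha hθ, hrho, lam_elt]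
      rintro ⟨rfl, -, h⟩
      exact ⟨rfl, ((lam_elt ha).1 h).2⟩
    refine ⟨⟨θ, bot_le, hθl⟩, funext fun I => Setoid.ext fun P Q => ?_⟩
    obtain ⟨s, rfl⟩ := exists_kerPart_eq I
    obtain ⟨k, rfl⟩ := exists_part P
    obtain ⟨l, rfl⟩ := exists_part Q
    rw [partFamily_part ha, hlam]
    rfl

theorem partFamily_isSubdirectEmbedding (ha : IsIdempotentElem a) (α : Fin r ≃ a.im) :
    IsSubdirectEmbedding (partFamily α ha) := by
  refine .of_range Coarser (fun _ _ _ => Coarser.trans) (fun _ _ => Coarser.antisymm)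
    (fun _ _ h => PartitionsOver.restrict α h) (fun I h P => ?_) (partFamily_injective ha α)
    (partFamily_inf ha) ?_
  · obtain ⟨k, rfl⟩ := exists_part P
    exact part_restrict k h
  · rw [range_partFamily ha]
    exact Set.ext fun _ => partClosed_iff

end

end VariantCong

open VariantCong in
theorem theorem3p1 {X : Type*} [Finite X] (a : Transf X) (ha : IsIdempotentElem a)
    (r : ℕ) (hrank : a.rank = r) (hr : 2 ≤ r) (α : Fin r ≃ a.im) :
    -- (i)
    (IsSubdirectEmbedding₂ (congMap ha α) ∧
      Set.range (congMap ha α) =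
        {p : Con (Transf (Fin r)) × Set.Icc (⊥ : Con (Reg a)) (kappa ha) |
          rankTr p.1 ≤ rankKappa ha p.2.1}) ∧
    -- (ii)
    IsLatticeIso (kappaMap ha) ∧
    -- (iii)
    (∃ Ψ : Set.Icc (⊥ : Con (Reg a)) (rho ha) → ∀ I : NESubset r, Setoid (CrossSections α I),
      (∀ θ I C C', Ψ θ I C C' ↔
        ∃ f g : Reg a, θ.1 f g ∧ f.1.toTransf.im = C.1 ∧ g.1.toTransf.im = C'.1) ∧
      IsSubdirectEmbedding Ψ ∧
      Set.range Ψ = {ψ | CrossClosed α ψ}) ∧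
    -- (iv)
    (∃ Ψ : Set.Icc (⊥ : Con (Reg a)) (lam ha) → ∀ I : Part r, Setoid (PartitionsOver α I),
      (∀ θ I Q Q', Ψ θ I Q Q' ↔
        ∃ f g : Reg a, θ.1 f g ∧ f.1.toTransf.kerClasses = Q.1 ∧ g.1.toTransf.kerClasses = Q'.1) ∧
      IsSubdirectEmbedding Ψ ∧
      Set.range Ψ = {ψ | PartClosed α ψ}) := by
  refine ⟨⟨congMap_isSubdirectEmbedding₂ ha hr α, ?_⟩, kappaMap_isLatticeIso ha α,
    ⟨crossFamily α ha, fun _ _ _ _ => Iff.rfl, crossFamily_isSubdirectEmbedding ha hr α,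
      range_crossFamily ha hr α⟩,
    ⟨partFamily α ha, fun _ _ _ _ => Iff.rfl, partFamily_isSubdirectEmbedding ha α,
      range_partFamily ha α⟩⟩
  rw [range_congMap ha hr]
  exact Set.ext fun p => (rankTr_le_rankKappa_iff ha hr hrank).symm
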